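/- Let $H$ be a complex Hilbert space and let $\mathfrak A\subset B(H)$ be a unital (i.e. $I_H\in\mathfrak A$) subalgebra that is closed in the weak-$*$ (ultraweak) topology. A weak-$*$ closed subalgebra $\mathfrak B\subset B(L)$, $L$ a Hilbert space, has property $\mathbb A_1(1)$ if every weak-$*$ continuous linear functional $f$ on $\mathfrak B$ with $\|f\|<1$ has the form $f(b)=\langle b\xi,\eta\rangle$ $(b\in\mathfrak B)$ for some $\xi,\eta\in L$ with $\|\xi\|<1$, $\|\eta\|<1$. Let $k\in\mathbb N$ and suppose that $M_k(\mathfrak A)$, acting on $H^{\oplus k}$, has property $\mathbb A_1(1)$. Let $\varphi\colon\mathfrak A\to M_k=M_k(\mathbb C)$ be a weak-$*$ continuous unital homomorphism. For each $n$ let $\varphi^{(n)}\colon M_n(\mathfrak A)\to M_n(M_k)$, $[a_{ij}]\mapsto[\varphi(a_{ij})]$, and let $\|\varphi\|_{cb}=\sup_n\|\varphi^{(n)}\|$, where matrices over $B(H)$ and over $M_k=B(\mathbb C^k)$ carry their operator norms on $H^{\oplus n}$ and $(\mathbb C^k)^{\oplus n}$. Then $\|\varphi\|_{cb}<\infty$,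 and there are, for every $\epsilon>0$, a subspace $K_\epsilon\subset H$ that is semi-invariant for $\mathfrak A$ (that is, $K_\epsilon=M\ominus N$ for closed $\mathfrak A$-invariant subspaces $N\subset M$ of $H$) and an invertible linear map $T_\epsilon\colon\mathbb C^k\to K_\epsilon$ such that $$\varphi(a)=T_\epsilon^{-1}\,P_{K_\epsilon}a|_{K_\epsilon}\,T_\epsilon\qquad\text{for every }a\in\mathfrak A,$$ and $$\lim_{\epsilon\to0+}\|T_\epsilon\|\,\|T_\epsilon^{-1}\|=\|\varphi\|_{cb}.$$ -/

import Mathlib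

open Filter Topology
open scoped ENNReal

noncomputable section

namespace DualOpAlg

/-- The pairing of `T ∈ B(H)` with the trace class operator determined by two square-summable
sequences `ξ`, `η`, that is `∑ₙ ⟨T ξₙ, ηₙ⟩`.  (Mathlib's inner product is linear in the second
variable.) -/
def pairing {H : Type*} [NormedAddCommGroup H] [InnerProductSpace ℂ H]
    (ξ η : lp (fun _ : ℕ => H) 2) (T : H →L[ℂ] H) : ℂ :=
  ∑' n, inner ℂ (η n) (T (ξ n))

/-- The series defining `pairing` always converges. -/
theorem summable_pairing {H : Type*} [NormedAddCommGroup H] [InnerProductSpace ℂ H]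
    (ξ η : lp (fun _ : ℕ => H) 2) (T : H →L[ℂ] H) :
    Summable fun n => inner ℂ (η n) (T (ξ n)) := by
  have hξ : Summable fun n => ‖ξ n‖ ^ 2 := by
    simpa using (lp.memℓp ξ).summable (by norm_num)
  have hη : Summable fun n => ‖η n‖ ^ 2 := by
    simpa using (lp.memℓp η).summable (by norm_num)
  refine Summable.of_norm_bounded ((hξ.mul_left (‖T‖ ^ 2)).add hη) fun n => ?_
  calc ‖inner ℂ (η n) (T (ξ n))‖ ≤ ‖η n‖ * ‖T (ξ n)‖ := norm_inner_le_norm _ _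
    _ ≤ ‖η n‖ * (‖T‖ * ‖ξ n‖) := by gcongr; exact T.le_opNorm _
    _ ≤ ‖T‖ ^ 2 * ‖ξ n‖ ^ 2 + ‖η n‖ ^ 2 := by
      nlinarith [sq_nonneg (‖η n‖ - ‖T‖ * ‖ξ n‖), sq_nonneg (‖η n‖), sq_nonneg (‖T‖ * ‖ξ n‖)]

/-- The weak-* (ultraweak, σ-weak) topology of `B(H)`, regarded as the dual of the trace class
operators. -/
@[reducible]
def weakStarTopology (H : Type*) [NormedAddCommGroup H] [InnerProductSpace ℂ H] :
    TopologicalSpace (H →L[ℂ] H) :=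
  ⨅ p : lp (fun _ : ℕ => H) 2 × lp (fun _ : ℕ => H) 2,
    TopologicalSpace.induced (pairing p.1 p.2) inferInstance

/-- The relative weak-* topology of an algebra `𝔄 ⊆ B(H)`. -/
@[reducible]
def weakStarTopologyOn {H : Type*} [NormedAddCommGroup H] [InnerProductSpace ℂ H]
    (𝔄 : Subalgebra ℂ (H →L[ℂ] H)) : TopologicalSpace 𝔄 :=
  (weakStarTopology H).induced Subtype.val

/-- Property `𝔸₁(1)`: every weak-* continuous functional of norm `< 1` on `𝔅 ⊆ B(H)` is of the form
`b ↦ ⟨b ξ, η⟩` with `‖ξ‖ < 1` and `‖η‖ < 1`. -/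
def HasA11 {H : Type*} [NormedAddCommGroup H] [InnerProductSpace ℂ H]
    (𝔅 : Subalgebra ℂ (H →L[ℂ] H)) : Prop :=
  ∀ f : 𝔅 →L[ℂ] ℂ, Continuous[weakStarTopologyOn 𝔅, inferInstance] f → ‖f‖ < 1 →
    ∃ ξ η : H, ‖ξ‖ < 1 ∧ ‖η‖ < 1 ∧ ∀ b : 𝔅, f b = inner ℂ η ((b : H →L[ℂ] H) ξ)

/-- The identification of `M_n(B(H))` with operators on the Hilbert space direct sum `H^{⊕n}`:
`(A x)ᵢ = ∑ⱼ Aᵢⱼ xⱼ`. -/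
def blockOp {H : Type*} [NormedAddCommGroup H] [InnerProductSpace ℂ H] (n : ℕ) :
    Matrix (Fin n) (Fin n) (H →L[ℂ] H) →ₐ[ℂ]
      (PiLp 2 (fun _ : Fin n => H) →L[ℂ] PiLp 2 (fun _ : Fin n => H)) :=
  AlgHom.ofLinearMap
    { toFun := fun A =>
        (PiLp.continuousLinearEquiv 2 ℂ (fun _ : Fin n => H)).symm.toContinuousLinearMap ∘L
          ContinuousLinearMap.pi fun i => ∑ j, A i j ∘L PiLp.proj 2 (fun _ : Fin n => H) j
      map_add' := fun A B => by
        ext x i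
        simp [Finset.sum_add_distrib]
      map_smul' := fun c A => by
        ext x i
        simp [Finset.smul_sum] }
    (by
      ext x i
      have h : ∀ j, ((1 : Matrix (Fin n) (Fin n) (H →L[ℂ] H)) i j) (x j) =
          if i = j then x j else 0 := fun j => by
        rw [Matrix.one_apply]; split_ifs <;> simp
      simp [h])
    (fun A B => by
      ext x i
      simp [Matrix.mul_apply]
      exact Finset.sum_comm)

theorem blockOp_apply {H : Type*} [NormedAddCommGroup H] [InnerProductSpace ℂ H] {n : ℕ}
    (A : Matrix (Fin n) (Fin n) (H →L[ℂ] H)) (x : PiLp 2 (fun _ : Fin n => H)) (i : Fin n) :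
    blockOp n A x i = ∑ j, A i j (x j) := by
  simp [blockOp]

/-- `M_n(𝔄)` as an algebra of operators on `H^{⊕n}`. -/
def matrixAlgebra {H : Type*} [NormedAddCommGroup H] [InnerProductSpace ℂ H] (n : ℕ)
    (𝔄 : Subalgebra ℂ (H →L[ℂ] H)) :
    Subalgebra ℂ (PiLp 2 (fun _ : Fin n => H) →L[ℂ] PiLp 2 (fun _ : Fin n => H)) :=
  𝔄.matrix.map (blockOp n)

/-- The completely bounded norm (possibly `∞`) of `φ : 𝔄 → B(F)`: the supremum over `n` of the
operator norms of the amplifications `[aᵢⱼ] ↦ [φ(aᵢⱼ)]`, `M_n(𝔄) → M_n(B(F)) = B(F^{⊕n})`. -/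
def cbNorm {H F : Type*} [NormedAddCommGroup H] [InnerProductSpace ℂ H]
    [NormedAddCommGroup F] [InnerProductSpace ℂ F]
    (𝔄 : Subalgebra ℂ (H →L[ℂ] H)) (φ : 𝔄 → (F →L[ℂ] F)) : ℝ≥0∞ :=
  ⨆ (n : ℕ) (A : Matrix (Fin n) (Fin n) 𝔄)
    (_ : ‖blockOp n (A.map fun a => (a : H →L[ℂ] H))‖ ≤ 1), ‖blockOp n (A.map φ)‖ₑ

/-- `K` is semi-invariant for `𝔄`: `K = M ⊖ N` for closed `𝔄`-invariant subspaces `N ⊆ M`. -/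
def IsSemiInvariant {H : Type*} [NormedAddCommGroup H] [InnerProductSpace ℂ H]
    (𝔄 : Subalgebra ℂ (H →L[ℂ] H)) (K : Submodule ℂ H) : Prop :=
  ∃ M N : Submodule ℂ H, IsClosed (M : Set H) ∧ IsClosed (N : Set H) ∧ N ≤ M ∧
    (∀ a ∈ 𝔄, ∀ x ∈ M, a x ∈ M) ∧ (∀ a ∈ 𝔄, ∀ x ∈ N, a x ∈ N) ∧ K = M ⊓ Nᗮ

/-- The compression `P_K a|_K : K → K`. -/
def compression {H : Type*} [NormedAddCommGroup H] [InnerProductSpace ℂ H]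
    (K : Submodule ℂ H) [K.HasOrthogonalProjection] (a : H →L[ℂ] H) : K →L[ℂ] K :=
  K.orthogonalProjectionOnto ∘L a ∘L K.subtypeL

end DualOpAlg

end

/-! The proof joins a finite-dimensional, quantitative form of Paulsen's similarity theorem to the
representation of functionals by vectors. Let `C` be the completely bounded norm, finite because
bounded functionals are completely bounded (`exists_cbBound`), and let `ρ < 1`.

Similarity (`CBBound.exists_similarity`). One seeks `1 ≤ g = S*S ≤ C²` with `∑ ⟨g (Ax)ᵢ, (Ax)ᵢ⟩ ≤ ∑
⟨g xᵢ, xᵢ⟩` for all matrices `A` over `𝔄` of norm at most `ρ` and all tuples `x`. Direct sums turn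
these conditions into a convex cone, so compactness and Hahn–Banach reduce to one pair `(A, x)`.
There the best `g` is `C²` on the nonnegative spectral part of `d = ∑ xᵢxᵢ* - ∑ (Ax)ᵢ(Ax)ᵢ*` and `1`
on the negative part, and the claim becomes `tr d⁻ ≤ C² tr d⁺`. With `r₁`, `r₂` the frames of `d⁻`,
`d⁺`, the tuples `(x, r₁)` and `(Ax, r₂)` have equal frame operators, hence differ by a scalar
isometry `W`. Solving `(x, r₁) = W (Ax, r₂)` for `r₁` gives `r₁ = F r₂`, with `F` a contraction over
`𝔄`, and the bound `C` applies to `F` (`sum_norm_sq_le_of_frame_eq`).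

Vectors (`HasA11.exists_vectors`, `exists_semiInvariant_of_vectors`). For `Ψ = S Φ S⁻¹`, property
`𝔸₁(1)` gives tuples with `⟨a ξⱼ, ηᵢ⟩ = ρ² Ψ(a)ᵢⱼ` and square norms summing to at most `k`. Taking
`a = 1` forces `ξ` and `η` to be close, so their synthesis operators have norm close to `1`. The
closed cyclic space `M` of `ξ`, modulo the part `N` killed by the adjoint of the synthesis of `η`,
is the semi-invariant space.

The condition number is then at most `C` times a factor tending to `1` as `ρ → 1`. It is at least
`C`, since compressions are completely contractive. -/

noncomputable section

namespace DualOpAlg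

/-! ### Matrices over an algebra acting on tuples of vectors -/

section Amplification

variable {R E : Type*} [Ring R] [Algebra ℂ R] [NormedAddCommGroup E] [InnerProductSpace ℂ E]
  {ι κ μ : Type*} [Fintype κ] [Fintype μ]

/-- The action of a (rectangular) matrix over `R` on tuples of vectors, through a representation
`θ` of `R`. -/
def amp (θ : R →ₐ[ℂ] (E →L[ℂ] E)) (A : Matrix ι κ R) (x : κ → E) : ι → E :=
  fun i => ∑ j, θ (A i j) (x j)

theorem amp_mul (θ : R →ₐ[ℂ] (E →L[ℂ] E)) (A : Matrix ι κ R) (B : Matrix κ μ R) (x : μ → E) :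
    amp θ (A * B) x = amp θ A (amp θ B x) := by
  funext i
  simp only [amp, Matrix.mul_apply, map_sum, map_mul, sum_apply,
    mul_apply_eq_comp]
  exact Finset.sum_comm

theorem amp_one [Fintype ι] [DecidableEq ι] (θ : R →ₐ[ℂ] (E →L[ℂ] E)) (x : ι → E) :
    amp θ (1 : Matrix ι ι R) x = x := by
  funext i
  have h : ∀ j, θ ((1 : Matrix ι ι R) i j) (x j) = if i = j then x j else 0 := fun j => by
    rw [Matrix.one_apply]; split_ifs <;> simp
  simp [amp, h]

theorem amp_sub (θ : R →ₐ[ℂ] (E →L[ℂ] E)) (A B : Matrix ι κ R) (x : κ → E) :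
    amp θ (A - B) x = amp θ A x - amp θ B x := by
  funext i
  simp [amp]

theorem amp_map_algebraMap (θ : R →ₐ[ℂ] (E →L[ℂ] E)) (W : Matrix ι κ ℂ) (x : κ → E) :
    amp θ (W.map (algebraMap ℂ R)) x = fun i => ∑ j, W i j • x j := by
  funext i
  simp [amp, Algebra.algebraMap_eq_smul_one]

theorem amp_smul (θ : R →ₐ[ℂ] (E →L[ℂ] E)) (c : ℂ) (A : Matrix ι κ R) (x : κ → E) :
    amp θ (c • A) x = c • amp θ A x := by
  funext i
  simp [amp, Finset.smul_sum]

theorem amp_smul_right (θ : R →ₐ[ℂ] (E →L[ℂ] E)) (c : ℂ) (A : Matrix ι κ R) (x : κ → E) :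
    amp θ A (c • x) = c • amp θ A x := by
  funext i
  simp [amp, Finset.smul_sum]

/-- The amplification `A` of `θ` has norm at most `ρ`. -/
def AmpBound [Fintype ι] (θ : R →ₐ[ℂ] (E →L[ℂ] E)) (ρ : ℝ) (A : Matrix ι κ R) : Prop :=
  ∀ x : κ → E, ∑ i, ‖amp θ A x i‖ ^ 2 ≤ ρ ^ 2 * ∑ j, ‖x j‖ ^ 2

/-- A scalar matrix with orthonormal columns acts isometrically on tuples of vectors. -/
theorem sum_norm_sq_of_conjTranspose_mul_self [Fintype ι] [DecidableEq κ] {W : Matrix ι κ ℂ}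
    (hW : W.conjTranspose * W = 1) (x : κ → E) :
    ∑ i, ‖∑ j, W i j • x j‖ ^ 2 = ∑ j, ‖x j‖ ^ 2 := by
  have h : ∀ j l, ∑ i, (starRingEnd ℂ) (W i j) * W i l = if j = l then 1 else 0 := fun j l => by
    have := congrFun (congrFun hW j) l
    simpa [Matrix.mul_apply, Matrix.one_apply] using this
  have key : ((∑ i, ‖∑ j, W i j • x j‖ ^ 2 : ℝ) : ℂ) = ((∑ j, ‖x j‖ ^ 2 : ℝ) : ℂ) := by
    push_cast
    calc ∑ i, ((‖∑ j, W i j • x j‖ : ℝ) : ℂ) ^ 2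
        = ∑ i, ∑ j, ∑ l, ((starRingEnd ℂ) (W i j) * W i l) * inner ℂ (x j) (x l) := by
          refine Finset.sum_congr rfl fun i _ => ?_
          have h0 := inner_self_eq_norm_sq_to_K (𝕜 := ℂ) (∑ j, W i j • x j)
          refine h0.symm.trans ?_
          rw [sum_inner]
          refine Finset.sum_congr rfl fun j _ => ?_
          rw [inner_sum]
          refine Finset.sum_congr rfl fun l _ => ?_
          rw [inner_smul_left, inner_smul_right, mul_assoc]
      _ = ∑ j, ∑ l, (∑ i, (starRingEnd ℂ) (W i j) * W i l) * inner ℂ (x j) (x l) := by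
          rw [Finset.sum_comm]
          refine Finset.sum_congr rfl fun j _ => ?_
          rw [Finset.sum_comm]
          refine Finset.sum_congr rfl fun l _ => ?_
          rw [Finset.sum_mul]
      _ = ∑ j, ((‖x j‖ : ℝ) : ℂ) ^ 2 := by
          refine Finset.sum_congr rfl fun j _ => ?_
          simp only [h, ite_mul, one_mul, zero_mul, Finset.sum_ite_eq, Finset.mem_univ, if_true]
          exact inner_self_eq_norm_sq_to_K (𝕜 := ℂ) (x j)
  exact_mod_cast key

end Amplification

/-! ### Equal frame operators, and a minimax principle -/

/-- Two tuples of vectors with the same frame operator differ by an isometric scalar matrix. -/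
theorem exists_isometry_of_frame_eq {V N : Type*} [NormedAddCommGroup V] [InnerProductSpace ℂ V]
    [Fintype N] [DecidableEq N] (z w : N → V)
    (h : ∀ v, ∑ s, ‖inner ℂ (z s) v‖ ^ 2 = ∑ s, ‖inner ℂ (w s) v‖ ^ 2) :
    ∃ W : Matrix N N ℂ, W.conjTranspose * W = 1 ∧ ∀ s, z s = ∑ t, W s t • w t := by
  let L : (N → V) → V →ₗ[ℂ] EuclideanSpace ℂ N := fun z =>
    (WithLp.linearEquiv 2 ℂ (N → ℂ)).symm.toLinearMap ∘ₗ
      LinearMap.pi fun s => (innerSL ℂ (z s)).toLinearMap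
  have hL : ∀ z v s, L z v s = inner ℂ (z s) v := fun z v s => by simp [L]
  have hn : ∀ v, ‖L z v‖ = ‖L w v‖ := fun v => by
    rw [EuclideanSpace.norm_eq, EuclideanSpace.norm_eq]
    simp only [hL, h]
  obtain ⟨g, hg⟩ := (L w).rangeRestrict.exists_rightInverse_of_surjective (L w).range_rangeRestrict
  have hg' : ∀ s, L w (g s) = s := fun s => congrArg Subtype.val (LinearMap.congr_fun hg s)
  -- `U₀` sends `L w v` to `L z v`; equality of the norms makes this independent of the preimage
  -- chosen by `g`.
  let U₀ : LinearMap.range (L w) →ₗᵢ[ℂ] EuclideanSpace ℂ N :=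
    { toLinearMap := L z ∘ₗ g
      norm_map' := fun s => by
        change ‖L z (g s)‖ = ‖s‖
        rw [hn, hg']; rfl }
  let U := U₀.extend
  have hU : ∀ v, U (L w v) = L z v := fun v => by
    have h1 := LinearIsometry.extend_apply U₀ ⟨L w v, v, rfl⟩
    refine h1.trans ?_
    change L z (g _) = L z v
    rw [← sub_eq_zero, ← map_sub, ← norm_eq_zero, hn, map_sub, hg']
    simp
  let e : N → EuclideanSpace ℂ N := fun t => EuclideanSpace.single t 1
  have hUe : ∀ x s, U x s = ∑ t, U (e t) s * x t := fun x s => by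
    conv_lhs => rw [← (EuclideanSpace.basisFun N ℂ).sum_repr x]
    simp [e, mul_comm]
  -- The inner product is conjugate linear in its first variable, so passing from the coefficients
  -- `⟨z s, v⟩` to the vectors `z s` conjugates the entries of `U`.
  refine ⟨Matrix.of fun s t => (starRingEnd ℂ) (U (e t) s), ?_, fun s => ?_⟩
  · ext t t'
    have h1 := U.inner_map_map (e t') (e t)
    rw [PiLp.inner_apply] at h1
    simp only [Matrix.mul_apply, Matrix.conjTranspose_apply, Matrix.of_apply, Matrix.one_apply]
    simp only [RCLike.inner_apply, e, EuclideanSpace.inner_single_left,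
      PiLp.single_apply, map_one, one_mul] at h1
    simp only [e, RCLike.star_def, RCLike.conj_conj]
    rw [h1]
    simp [eq_comm]
  · refine ext_inner_right ℂ fun v => ?_
    rw [sum_inner, ← hL z v s, ← hU, hUe]
    refine Finset.sum_congr rfl fun t _ => ?_
    rw [inner_smul_left, hL]
    simp

/-- A family of linear inequalities, closed under nonnegative combinations, has a common solution
in a compact convex set as soon as each single inequality has one. -/
theorem exists_forall_nonneg_of_forall_exists {E : Type*} [NormedAddCommGroup E]
    [NormedSpace ℝ E] {Γ : Set E} (hc : IsCompact Γ) (hv : Convex ℝ Γ)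
    (D : Set (E →L[ℝ] ℝ)) (h0 : 0 ∈ D) (hadd : ∀ a ∈ D, ∀ b ∈ D, a + b ∈ D)
    (hsmul : ∀ t : ℝ, 0 ≤ t → ∀ a ∈ D, t • a ∈ D) (h : ∀ a ∈ D, ∃ g ∈ Γ, 0 ≤ a g) :
    ∃ g ∈ Γ, ∀ a ∈ D, 0 ≤ a g := by
  classical
  suffices hs : (Γ ∩ ⋂ a : D, {g | 0 ≤ a.1 g}).Nonempty by
    obtain ⟨g, hg, hg'⟩ := hs
    exact ⟨g, hg, fun a ha => Set.mem_iInter.1 hg' ⟨a, ha⟩⟩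
  refine hc.inter_iInter_nonempty _
    (fun a => isClosed_le continuous_const a.1.continuous) fun u => ?_
  by_contra hne
  let L : E →L[ℝ] (u → ℝ) := ContinuousLinearMap.pi fun a => a.1.1
  let O : Set (u → ℝ) := {p | ∀ i, 0 ≤ p i}
  have hO : IsClosed O := by
    simp only [O, Set.ofPred_forall]
    exact isClosed_iInter fun i => isClosed_le continuous_const (continuous_apply i)
  have hOc : Convex ℝ O := fun p hp q hq a b ha hb _ i => by
    have := mul_nonneg ha (hp i)
    have := mul_nonneg hb (hq i)
    simp only [Pi.add_apply, Pi.smul_apply, smul_eq_mul]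
    positivity
  have hdisj : Disjoint (L '' Γ) O := by
    rw [Set.disjoint_left]
    rintro _ ⟨g, hg, rfl⟩ hgO
    exact hne ⟨g, hg, Set.mem_iInter₂.2 fun a ha => hgO ⟨a, ha⟩⟩
  -- If finitely many of the inequalities have no common solution, the image of `Γ` is separated
  -- from the positive orthant. The separating `f` has nonnegative coefficients, so it combines the
  -- inequalities into a member of `D` that is negative on all of `Γ`.
  obtain ⟨f, s, t, hs, hst, ht⟩ := geometric_hahn_banach_compact_closed
    (hv.linear_image L.toLinearMap) (hc.image L.continuous) hOc hO hdisj
  have ht0 : t < 0 := by simpa using ht 0 fun i => le_rfl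
  have hf : ∀ p, f p = ∑ i, p i * f (Pi.single i 1) := fun p => by
    conv_lhs => rw [← Finset.univ_sum_single p, map_sum]
    refine Finset.sum_congr rfl fun i _ => ?_
    rw [← smul_eq_mul, ← map_smul, ← Pi.single_smul, smul_eq_mul, mul_one]
  have hpos : ∀ i, 0 ≤ f (Pi.single i 1) := fun i => by
    by_contra! hi
    -- A negative coefficient would let `f` take the value `t` itself at a point of the orthant.
    have h1 := ht ((t / f (Pi.single i 1)) • Pi.single i 1) fun j => by
      have : 0 ≤ t / f (Pi.single i 1) := div_nonneg_of_nonpos ht0.le hi.le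
      have h2 : 0 ≤ (Pi.single i (1 : ℝ) : u → ℝ) j := by
        rw [Pi.single_apply]; split_ifs <;> norm_num
      simpa using mul_nonneg this h2
    rw [map_smul, smul_eq_mul, div_mul_cancel₀ _ hi.ne] at h1
    exact lt_irrefl _ h1
  have hmem : ∀ v : Finset u, ∑ i ∈ v, f (Pi.single i 1) • i.1.1 ∈ D := fun v => by
    induction v using Finset.induction_on with
    | empty => simpa using h0
    | insert i v hi ih =>
      rw [Finset.sum_insert hi]
      exact hadd _ (hsmul _ (hpos i) _ i.1.2) _ ih
  obtain ⟨g, hg, hg0⟩ := h _ (hmem Finset.univ)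
  have h1 := hs _ ⟨g, hg, rfl⟩
  have h2 : f (L g) = (∑ i : u, f (Pi.single i 1) • i.1.1) g := by
    rw [hf]
    simp [L, mul_comm]
  have h3 : f (L g) < s := h1
  linarith

end DualOpAlg

/-! ### The similarity inequality for a single contraction and tuple -/

namespace DualOpAlg

/-- `1 - D` is invertible over `R` for every strict contraction `D` (measured through `θ`). -/
def InvertibleNearOne {R E : Type*} [Ring R] [Algebra ℂ R] [NormedAddCommGroup E]
    [InnerProductSpace ℂ E] (θ : R →ₐ[ℂ] (E →L[ℂ] E)) : Prop :=
  ∀ (N : Type) [Fintype N] [DecidableEq N] (D : Matrix N N R) (ρ : ℝ), 0 ≤ ρ → ρ < 1 →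
    AmpBound θ ρ D → IsUnit (1 - D)

/-- `Φ` is completely bounded by `C`, where matrices over `R` are measured through `θ`. -/
def CBBound {R E V : Type*} [Ring R] [Algebra ℂ R] [NormedAddCommGroup E]
    [InnerProductSpace ℂ E] [NormedAddCommGroup V] [InnerProductSpace ℂ V]
    (θ : R →ₐ[ℂ] (E →L[ℂ] E)) (Φ : R →ₐ[ℂ] (V →L[ℂ] V)) (C : ℝ) : Prop :=
  ∀ (N : Type) [Fintype N] (A : Matrix N N R), AmpBound θ 1 A → AmpBound Φ C A

variable {R E V : Type*} [Ring R] [Algebra ℂ R] [NormedAddCommGroup E] [InnerProductSpace ℂ E]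
  [NormedAddCommGroup V] [InnerProductSpace ℂ V]
  {θ : R →ₐ[ℂ] (E →L[ℂ] E)} {Φ : R →ₐ[ℂ] (V →L[ℂ] V)} {C : ℝ}

theorem amp_fromBlocks_zero {ι κ : Type*} [Fintype ι] [Fintype κ] (θ : R →ₐ[ℂ] (E →L[ℂ] E))
    (A : Matrix ι ι R) (B : Matrix κ κ R) (x : ι ⊕ κ → E) :
    amp θ (Matrix.fromBlocks A 0 0 B) x =
      Sum.elim (amp θ A (x ∘ Sum.inl)) (amp θ B (x ∘ Sum.inr)) := by
  funext s
  rcases s with i | j <;> simp [amp]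

theorem amp_toBlocks₂₂ {ι κ : Type*} [Fintype ι] [Fintype κ] (θ : R →ₐ[ℂ] (E →L[ℂ] E))
    (A : Matrix (ι ⊕ κ) (ι ⊕ κ) R) (u : κ → E) (j : κ) :
    amp θ A.toBlocks₂₂ u j = amp θ A (Sum.elim 0 u) (Sum.inr j) := by
  simp [amp, Matrix.toBlocks₂₂]

theorem inner_mul_inner_swap_eq (v w : V) :
    inner ℂ v w * inner ℂ w v = ((‖inner ℂ w v‖ ^ 2 : ℝ) : ℂ) := by
  rw [← inner_conj_symm v, mul_comm, RCLike.mul_conj]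
  push_cast; rfl

/-- If adjoining `r₂` to the image of `x` under a strict contraction gives the same frame operator
as adjoining `r₁` to `x`, then `r₁` is the image of `r₂` under a linear fractional transform of that
contraction, which is again a contraction. -/
theorem sum_norm_sq_le_of_frame_eq (hinv : InvertibleNearOne θ) (hcb : CBBound θ Φ C)
    {ι κ : Type} [Fintype ι] [Fintype κ] {ρ : ℝ} (hρ0 : 0 ≤ ρ) (hρ : ρ < 1)
    {A : Matrix ι ι R} (hA : AmpBound θ ρ A) (x : ι → V) (r₁ r₂ : κ → V)
    (h : ∀ v, ∑ i, ‖inner ℂ (x i) v‖ ^ 2 + ∑ j, ‖inner ℂ (r₁ j) v‖ ^ 2 =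
      ∑ i, ‖inner ℂ (amp Φ A x i) v‖ ^ 2 + ∑ j, ‖inner ℂ (r₂ j) v‖ ^ 2) :
    ∑ j, ‖r₁ j‖ ^ 2 ≤ C ^ 2 * ∑ j, ‖r₂ j‖ ^ 2 := by
  classical
  obtain ⟨W, hW, hzw⟩ := exists_isometry_of_frame_eq (Sum.elim x r₁) (Sum.elim (amp Φ A x) r₂)
    (fun v => by simpa using h v)
  let W' : Matrix (ι ⊕ κ) (ι ⊕ κ) R := W.map (algebraMap ℂ R)
  let A' : Matrix (ι ⊕ κ) (ι ⊕ κ) R := Matrix.fromBlocks A 0 0 0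
  have hA' : ∀ y : ι ⊕ κ → E, amp θ A' y = Sum.elim (amp θ A (y ∘ Sum.inl)) 0 := fun y => by
    rw [amp_fromBlocks_zero]
    congr 1
    funext j
    simp [amp]
  have hA'V : ∀ y : ι ⊕ κ → V, amp Φ A' y = Sum.elim (amp Φ A (y ∘ Sum.inl)) 0 := fun y => by
    rw [amp_fromBlocks_zero]
    congr 1
    funext j
    simp [amp]
  have hWn : ∀ y : ι ⊕ κ → E, ∑ s, ‖amp θ W' y s‖ ^ 2 = ∑ s, ‖y s‖ ^ 2 := fun y => by
    rw [amp_map_algebraMap]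
    exact sum_norm_sq_of_conjTranspose_mul_self hW y
  have hD : AmpBound θ ρ (W' * A') := fun y => by
    rw [amp_mul, hWn, hA', Fintype.sum_sum_type, Fintype.sum_sum_type]
    have h1 := hA (y ∘ Sum.inl)
    have h2 : 0 ≤ ρ ^ 2 * ∑ j, ‖y (Sum.inr j)‖ ^ 2 := by positivity
    simp only [Sum.elim_inl, Sum.elim_inr, Pi.zero_apply, norm_zero, Function.comp_apply] at h1 ⊢
    norm_num
    linarith
  obtain ⟨⟨_, G, hG, hG'⟩, rfl⟩ := hinv _ _ ρ hρ0 hρ hD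
  -- The relation `(x, r₁) = W' (A' (x, r₁) + (0, r₂))` is solved by the resolvent `G`; `F` is the
  -- corner taking `r₂` to `r₁`.
  let F : Matrix κ κ R := (G * W').toBlocks₂₂
  -- Energy balance: `y = W' (A y₁, u)` with `W'` isometric gives `‖y₁‖² + ‖y₂‖² = ‖A y₁‖² + ‖u‖²`,
  -- and `‖A y₁‖ ≤ ‖y₁‖`.
  have hFn : AmpBound θ 1 F := fun u => by
    set y := amp θ (G * W') (Sum.elim 0 u) with hy
    have h1 : y = amp θ W' (Sum.elim (amp θ A (y ∘ Sum.inl)) u) := by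
      have h2 : amp θ (1 - W' * A') y = amp θ W' (Sum.elim 0 u) := by
        rw [hy, ← amp_mul, ← Matrix.mul_assoc, hG, Matrix.one_mul]
      rw [amp_sub, amp_one, amp_mul, hA', sub_eq_iff_eq_add] at h2
      refine h2.trans ?_
      funext s
      simp only [amp, Pi.add_apply, ← Finset.sum_add_distrib, ← map_add]
      refine Finset.sum_congr rfl fun t _ => ?_
      rcases t with t | t <;> simp [amp]
    have h3 := hWn (Sum.elim (amp θ A (y ∘ Sum.inl)) u)
    rw [← h1, Fintype.sum_sum_type, Fintype.sum_sum_type] at h3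
    have h4 := hA (y ∘ Sum.inl)
    have h5 : 0 ≤ ∑ i, ‖y (Sum.inl i)‖ ^ 2 := by positivity
    simp only [F, amp_toBlocks₂₂, ← hy]
    simp only [Sum.elim_inl, Sum.elim_inr, Function.comp_apply] at h3 h4
    have h6 := mul_le_of_le_one_left h5 (pow_le_one₀ hρ0 hρ.le : ρ ^ 2 ≤ 1)
    linarith
  have hr : r₁ = amp Φ F r₂ := by
    have h1 : Sum.elim x r₁ = amp Φ W' (Sum.elim (amp Φ A x) r₂) := by
      rw [amp_map_algebraMap]
      exact funext hzw
    have h2 : amp Φ (1 - W' * A') (Sum.elim x r₁) = amp Φ W' (Sum.elim 0 r₂) := by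
      rw [amp_sub, amp_one, amp_mul, hA'V, Sum.elim_comp_inl, sub_eq_iff_eq_add]
      refine h1.trans ?_
      funext s
      simp only [amp, Pi.add_apply, ← Finset.sum_add_distrib, ← map_add]
      refine Finset.sum_congr rfl fun t _ => ?_
      rcases t with t | t <;> simp [amp]
    funext j
    rw [amp_toBlocks₂₂, amp_mul, ← h2, ← amp_mul, hG', amp_one, Sum.elim_inr]
  rw [hr]
  exact hcb κ F hFn r₂

variable [FiniteDimensional ℂ V]

/-- The inequality `∑ ⟨g (Ax)ᵢ, (Ax)ᵢ⟩ ≤ ∑ ⟨g xᵢ, xᵢ⟩` for one contraction `A` and one tuple `x`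
has a solution `1 ≤ g ≤ C²`. -/
theorem exists_operator_of_tuple (hinv : InvertibleNearOne θ) (hcb : CBBound θ Φ C) (hC : 1 ≤ C)
    {ι : Type} [Fintype ι] {ρ : ℝ} (hρ0 : 0 ≤ ρ) (hρ : ρ < 1)
    {A : Matrix ι ι R} (hA : AmpBound θ ρ A) (x : ι → V) :
    ∃ g : V →L[ℂ] V, (∀ v w, inner ℂ (g v) w = inner ℂ v (g w)) ∧
      (∀ v, ‖v‖ ^ 2 ≤ (inner ℂ v (g v)).re) ∧ (∀ v, (inner ℂ v (g v)).re ≤ C ^ 2 * ‖v‖ ^ 2) ∧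
      ∑ i, (inner ℂ (amp Φ A x i) (g (amp Φ A x i))).re ≤ ∑ i, (inner ℂ (x i) (g (x i))).re := by
  set y := amp Φ A x with hy
  -- The inequality sought says that the trace of `g d` is nonnegative.
  let d : V →ₗ[ℂ] V := ∑ i, ((innerSL ℂ (x i)).toLinearMap.smulRight (x i) -
    (innerSL ℂ (y i)).toLinearMap.smulRight (y i))
  have hd : ∀ v, d v = ∑ i, (inner ℂ (x i) v • x i - inner ℂ (y i) v • y i) := fun v => by
    simp [d]
  have hdi : ∀ v w, inner ℂ w (d v) = ∑ i, (inner ℂ (x i) v * inner ℂ w (x i) -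
      inner ℂ (y i) v * inner ℂ w (y i)) := fun v w => by
    simp_rw [hd, inner_sum, inner_sub_right, inner_smul_right]
  have hsym : d.IsSymmetric := fun v w => by
    rw [← inner_conj_symm, hdi, hdi, map_sum]
    refine Finset.sum_congr rfl fun i _ => ?_
    simp [inner_conj_symm, mul_comm]
  let b := hsym.eigenvectorBasis rfl
  let e := hsym.eigenvalues rfl
  have hb : ∀ j, d (b j) = (e j : ℂ) • b j := fun j => hsym.apply_eigenvectorBasis rfl j
  have hpars : ∀ v w, inner ℂ v w = ∑ j, inner ℂ v (b j) * inner ℂ (b j) w := fun v w =>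
    (b.sum_inner_mul_inner v w).symm
  have hnorm : ∀ v, ‖v‖ ^ 2 = ∑ j, ‖inner ℂ (b j) v‖ ^ 2 := fun v =>
    (b.sum_sq_norm_inner_right v).symm
  -- eigenvalues through the frame
  have he : ∀ j, e j = ∑ i, ‖inner ℂ (b j) (x i)‖ ^ 2 - ∑ i, ‖inner ℂ (b j) (y i)‖ ^ 2 :=
    fun j => by
      have h1 := hdi (b j) (b j)
      rw [hb, inner_smul_right, inner_self_eq_norm_sq_to_K, b.orthonormal.1 j] at h1
      simp only [inner_mul_inner_swap_eq] at h1
      rw [← Finset.sum_sub_distrib]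
      have h3 : ((e j : ℝ) : ℂ) = ((∑ i, (‖inner ℂ (b j) (x i)‖ ^ 2 -
        ‖inner ℂ (b j) (y i)‖ ^ 2) : ℝ) : ℂ) := by
          push_cast
          simpa using h1
      exact_mod_cast h3
  -- This choice of eigenvalues in `[1, C²]` maximizes the trace of `g d`, giving `C² tr d⁺ - tr
  -- d⁻`.
  let c : Fin (Module.finrank ℂ V) → ℝ := fun j => if 0 ≤ e j then C ^ 2 else 1
  have hC2 : 1 ≤ C ^ 2 := by nlinarith
  have hc1 : ∀ j, 1 ≤ c j := fun j => by simp only [c]; split_ifs <;> linarith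
  have hc2 : ∀ j, c j ≤ C ^ 2 := fun j => by simp only [c]; split_ifs <;> linarith
  let g : V →L[ℂ] V := ∑ j, ((c j : ℂ) • (innerSL ℂ (b j))).smulRight (b j)
  have hgi : ∀ v w, inner ℂ v (g w) = ∑ j, (c j : ℂ) * (inner ℂ v (b j) * inner ℂ (b j) w) :=
    fun v w => by
      simp only [g, sum_apply, inner_sum, ContinuousLinearMap.smulRight_apply,
        inner_smul_right, smul_apply, innerSL_apply_apply, smul_eq_mul]
      refine Finset.sum_congr rfl fun j _ => ?_
      ring
  have hgq : ∀ v, (inner ℂ v (g v)).re = ∑ j, c j * ‖inner ℂ (b j) v‖ ^ 2 := fun v => by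
    rw [hgi, Complex.re_sum]
    refine Finset.sum_congr rfl fun j _ => ?_
    rw [inner_mul_inner_swap_eq, ← Complex.ofReal_mul, Complex.ofReal_re]
  refine ⟨g, fun v w => ?_, fun v => ?_, fun v => ?_, ?_⟩
  · rw [← inner_conj_symm, hgi, hgi, map_sum]
    refine Finset.sum_congr rfl fun j _ => ?_
    simp [inner_conj_symm, mul_comm]
  · rw [hgq, hnorm]
    exact Finset.sum_le_sum fun j _ => le_mul_of_one_le_left (by positivity) (hc1 j)
  · rw [hgq, hnorm, Finset.mul_sum]
    exact Finset.sum_le_sum fun j _ => mul_le_mul_of_nonneg_right (hc2 j) (by positivity)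
  -- The added tuples have frame operators `d⁻` and `d⁺`, so the hypothesis on frames is `d = d⁺ -
  -- d⁻` rearranged.
  · have hframe := sum_norm_sq_le_of_frame_eq hinv hcb hρ0 hρ hA x
      (fun j => ((√(e j)⁻ : ℝ) : ℂ) • b j) (fun j => ((√(e j)⁺ : ℝ) : ℂ) • b j) ?_
    · have hr : ∀ t : ℝ, 0 ≤ t → ∀ j, ‖((√t : ℝ) : ℂ) • b j‖ ^ 2 = t := fun t ht j => by
        rw [norm_smul, b.orthonormal.1 j, mul_one, Complex.norm_real, Real.norm_eq_abs, sq_abs,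
          Real.sq_sqrt ht]
      have h1 : ∀ j, ‖((√(e j)⁻ : ℝ) : ℂ) • b j‖ ^ 2 = (e j)⁻ := fun j => hr _ (negPart_nonneg _) j
      have h2 : ∀ j, ‖((√(e j)⁺ : ℝ) : ℂ) • b j‖ ^ 2 = (e j)⁺ := fun j => hr _ (posPart_nonneg _) j
      simp only [h1, h2] at hframe
      have h3 : ∑ i, (inner ℂ (x i) (g (x i))).re - ∑ i, (inner ℂ (y i) (g (y i))).re =
          ∑ j, c j * e j := by
        simp only [hgq, he, mul_sub, Finset.sum_sub_distrib, Finset.mul_sum]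
        congr 1 <;> exact Finset.sum_comm
      have h4 : ∀ j, c j * e j = C ^ 2 * (e j)⁺ - (e j)⁻ := fun j => by
        simp only [c]
        split_ifs with hj
        · rw [posPart_eq_self.2 hj, negPart_eq_zero.2 hj, sub_zero]
        · have hj' : e j ≤ 0 := (not_le.1 hj).le
          rw [posPart_eq_zero.2 hj', negPart_eq_neg.2 hj']; ring
      simp only [h4, Finset.sum_sub_distrib, ← Finset.mul_sum] at h3
      linarith
    · intro v
      have hr : ∀ t : ℝ, 0 ≤ t → ∀ j, ‖inner ℂ (((√t : ℝ) : ℂ) • b j) v‖ ^ 2 =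
          t * ‖inner ℂ (b j) v‖ ^ 2 := fun t ht j => by
        rw [inner_smul_left, norm_mul, RCLike.norm_conj, Complex.norm_real, Real.norm_eq_abs,
          mul_pow, sq_abs, Real.sq_sqrt ht]
      have h1 : ∀ j, ‖inner ℂ (((√(e j)⁻ : ℝ) : ℂ) • b j) v‖ ^ 2 =
        (e j)⁻ * ‖inner ℂ (b j) v‖ ^ 2 := fun j => hr _ (negPart_nonneg _) j
      have h2 : ∀ j, ‖inner ℂ (((√(e j)⁺ : ℝ) : ℂ) • b j) v‖ ^ 2 =
        (e j)⁺ * ‖inner ℂ (b j) v‖ ^ 2 := fun j => hr _ (posPart_nonneg _) j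
      simp only [h1, h2]
      have h3 : (inner ℂ v (d v)).re =
          ∑ i, ‖inner ℂ (x i) v‖ ^ 2 - ∑ i, ‖inner ℂ (y i) v‖ ^ 2 := by
        rw [hdi, Complex.re_sum, ← Finset.sum_sub_distrib]
        refine Finset.sum_congr rfl fun i _ => ?_
        rw [← inner_conj_symm v, ← inner_conj_symm v, RCLike.mul_conj, RCLike.mul_conj]
        norm_cast
      have h4 : (inner ℂ v (d v)).re = ∑ j, e j * ‖inner ℂ (b j) v‖ ^ 2 := by
        rw [hpars, Complex.re_sum]
        refine Finset.sum_congr rfl fun j _ => ?_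
        rw [← hsym, hb, inner_smul_left, mul_left_comm, inner_mul_inner_swap_eq,
          Complex.conj_ofReal, ← Complex.ofReal_mul, Complex.ofReal_re]
      have h5 : ∀ j, e j = (e j)⁺ - (e j)⁻ := fun j => (posPart_sub_negPart _).symm
      have h6 : ∑ j, e j * ‖inner ℂ (b j) v‖ ^ 2 = ∑ j, (e j)⁺ * ‖inner ℂ (b j) v‖ ^ 2 -
          ∑ j, (e j)⁻ * ‖inner ℂ (b j) v‖ ^ 2 := by
        rw [← Finset.sum_sub_distrib]
        refine Finset.sum_congr rfl fun j _ => ?_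
        rw [← sub_mul, ← h5]
      linarith

end DualOpAlg

/-! ### One similarity for all contractions at once -/

namespace DualOpAlg

variable {R E V : Type*} [Ring R] [Algebra ℂ R] [NormedAddCommGroup E] [InnerProductSpace ℂ E]
  [NormedAddCommGroup V] [InnerProductSpace ℂ V]
  {θ : R →ₐ[ℂ] (E →L[ℂ] E)} {Φ : R →ₐ[ℂ] (V →L[ℂ] V)} {C : ℝ}

/-- The quadratic form `g ↦ Re ⟨v, g v⟩`. -/
def reQuad (v : V) : (V →L[ℂ] V) →L[ℝ] ℝ :=
  Complex.reCLM ∘L ((innerSL ℂ v) ∘L (ContinuousLinearMap.apply ℂ V v)).restrictScalars ℝ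

theorem reQuad_apply (v : V) (g : V →L[ℂ] V) : reQuad v g = (inner ℂ v (g v)).re := by
  simp [reQuad]

theorem reQuad_smul (c : ℂ) (v : V) : reQuad (c • v) = (‖c‖ ^ 2) • reQuad v := by
  ext g
  simp only [reQuad_apply, map_smul, inner_smul_left, inner_smul_right, smul_apply, smul_eq_mul]
  rw [← mul_assoc, RCLike.mul_conj, ← RCLike.ofReal_pow]
  exact Complex.re_ofReal_mul _ _

variable [FiniteDimensional ℂ V]

/-- A completely bounded representation on a finite dimensional space is similar to one which is
completely contractive up to the factor `ρ⁻¹`, the similarity having condition number at most the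
completely bounded norm. -/
theorem CBBound.exists_similarity (hinv : InvertibleNearOne θ) (hcb : CBBound θ Φ C) (hC : 1 ≤ C)
    {ρ : ℝ} (hρ0 : 0 ≤ ρ) (hρ : ρ < 1) :
    ∃ S : V →L[ℂ] V, (∀ v, ‖v‖ ≤ ‖S v‖) ∧ (∀ v, ‖S v‖ ≤ C * ‖v‖) ∧
      ∀ (ι : Type) [Fintype ι] (A : Matrix ι ι R) (x : ι → V), AmpBound θ ρ A →
        ∑ i, ‖S (amp Φ A x i)‖ ^ 2 ≤ ∑ i, ‖S (x i)‖ ^ 2 := by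
  have : ProperSpace (V →L[ℂ] V) := FiniteDimensional.proper ℂ _
  have hC0 : 0 ≤ C := by linarith
  let Γ : Set (V →L[ℂ] V) := {g | (∀ v w, inner ℂ (g v) w = inner ℂ v (g w)) ∧
    (∀ v, ‖v‖ ^ 2 ≤ reQuad v g) ∧ ∀ v, reQuad v g ≤ C ^ 2 * ‖v‖ ^ 2}
  have hroot : ∀ g ∈ Γ, ∃ S : V →L[ℂ] V, g = star S * S ∧ ∀ v, reQuad v g = ‖S v‖ ^ 2 := by
    rintro g ⟨h1, h2, -⟩
    have hg : 0 ≤ g := by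
      rw [ContinuousLinearMap.nonneg_iff_isPositive]
      refine ⟨fun v w => h1 v w, fun v => ?_⟩
      have h3 := h2 v
      rw [reQuad_apply, ← h1] at h3
      exact (sq_nonneg _).trans h3
    obtain ⟨S, hS⟩ := CStarAlgebra.nonneg_iff_eq_star_mul_self.1 hg
    refine ⟨S, hS, fun v => ?_⟩
    rw [reQuad_apply, hS, ContinuousLinearMap.star_eq_adjoint, mul_apply_eq_comp,
      ContinuousLinearMap.adjoint_inner_right]
    exact inner_self_eq_norm_sq (𝕜 := ℂ) (S v)
  have hS : ∀ S : V →L[ℂ] V, (∀ v, ‖S v‖ ^ 2 ≤ C ^ 2 * ‖v‖ ^ 2) → ∀ v, ‖S v‖ ≤ C * ‖v‖ :=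
    fun S h v => by
      refine le_of_sq_le_sq ?_ (by positivity)
      rw [mul_pow]
      exact h v
  have hΓc : IsCompact Γ := by
    refine Metric.isCompact_of_isClosed_isBounded ?_ ?_
    · refine IsClosed.and ?_ (IsClosed.and ?_ ?_)
      · simp only [Set.ofPred_forall]
        refine isClosed_iInter fun v => isClosed_iInter fun w => isClosed_eq ?_ ?_ <;> fun_prop
      · simp only [Set.ofPred_forall]
        exact isClosed_iInter fun v => isClosed_le continuous_const (reQuad v).continuous
      · simp only [Set.ofPred_forall]
        exact isClosed_iInter fun v => isClosed_le (reQuad v).continuous continuous_const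
    · rw [isBounded_iff_forall_norm_le]
      refine ⟨C * C, fun g hg => ?_⟩
      obtain ⟨S, rfl, hS'⟩ := hroot g hg
      refine (ContinuousLinearMap.norm_adjoint_comp_self S).trans_le ?_
      have : ‖S‖ ≤ C := S.opNorm_le_bound hC0 (hS S fun v => (hS' v).symm.le.trans (hg.2.2 v))
      gcongr
  have hΓv : Convex ℝ Γ := by
    rintro g ⟨hg1, hg2, hg3⟩ h ⟨hh1, hh2, hh3⟩ a b ha hb hab
    refine ⟨fun v w => ?_, fun v => ?_, fun v => ?_⟩
    · simp only [add_apply, smul_apply, inner_add_left, inner_add_right, inner_smul_left_eq_smul,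
        inner_smul_right_eq_smul, hg1, hh1]
    · rw [map_add, map_smul, map_smul, smul_eq_mul, smul_eq_mul]
      have := mul_le_mul_of_nonneg_left (hg2 v) ha
      have := mul_le_mul_of_nonneg_left (hh2 v) hb
      have : ‖v‖ ^ 2 = a * ‖v‖ ^ 2 + b * ‖v‖ ^ 2 := by rw [← add_mul, hab, one_mul]
      linarith
    · rw [map_add, map_smul, map_smul, smul_eq_mul, smul_eq_mul]
      have := mul_le_mul_of_nonneg_left (hg3 v) ha
      have := mul_le_mul_of_nonneg_left (hh3 v) hb
      have : C ^ 2 * ‖v‖ ^ 2 = a * (C ^ 2 * ‖v‖ ^ 2) + b * (C ^ 2 * ‖v‖ ^ 2) := by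
        rw [← add_mul, hab, one_mul]
      linarith
  -- The index type is allowed to vary so that block diagonal sums make `D` closed under addition;
  -- scaling `x` by `√t` gives nonnegative multiples.
  let D : Set ((V →L[ℂ] V) →L[ℝ] ℝ) := {l | ∃ (ι : Type) (_ : Fintype ι) (A : Matrix ι ι R)
    (x : ι → V), AmpBound θ ρ A ∧ l = ∑ i, reQuad (x i) - ∑ i, reQuad (amp Φ A x i)}
  have key : ∃ g ∈ Γ, ∀ l ∈ D, 0 ≤ l g := by
    refine exists_forall_nonneg_of_forall_exists hΓc hΓv D ?_ ?_ ?_ ?_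
    · exact ⟨Empty, inferInstance, 0, fun _ => 0, fun x => by simp, by simp⟩
    · rintro _ ⟨ι, _, A, x, hA, rfl⟩ _ ⟨κ, _, B, y, hB, rfl⟩
      refine ⟨ι ⊕ κ, inferInstance, Matrix.fromBlocks A 0 0 B, Sum.elim x y, fun z => ?_, ?_⟩
      · have h1 := hA (z ∘ Sum.inl)
        have h2 := hB (z ∘ Sum.inr)
        simp only [amp_fromBlocks_zero, Fintype.sum_sum_type, Sum.elim_inl, Sum.elim_inr,
          Function.comp_apply] at h1 h2 ⊢
        linarith
      · simp only [amp_fromBlocks_zero, Fintype.sum_sum_type, Sum.elim_inl, Sum.elim_inr,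
          Sum.elim_comp_inl, Sum.elim_comp_inr]
        abel
    · rintro t ht _ ⟨ι, _, A, x, hA, rfl⟩
      refine ⟨ι, _, A, ((√t : ℝ) : ℂ) • x, hA, ?_⟩
      have : ‖((√t : ℝ) : ℂ)‖ ^ 2 = t := by
        rw [Complex.norm_real, Real.norm_eq_abs, sq_abs, Real.sq_sqrt ht]
      simp only [amp_smul_right, Pi.smul_apply, reQuad_smul, this, smul_sub, Finset.smul_sum]
    · rintro _ ⟨ι, _, A, x, hA, rfl⟩
      obtain ⟨g, h1, h2, h3, h4⟩ := exists_operator_of_tuple hinv hcb hC hρ0 hρ hA x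
      refine ⟨g, ⟨h1, fun v => ?_, fun v => ?_⟩, ?_⟩
      · rw [reQuad_apply]; exact h2 v
      · rw [reQuad_apply]; exact h3 v
      · simp only [sub_apply, sum_apply, reQuad_apply]
        linarith
  obtain ⟨g, hg, hgD⟩ := key
  obtain ⟨S, -, hS'⟩ := hroot g hg
  refine ⟨S, fun v => ?_, hS S fun v => (hS' v).symm.le.trans (hg.2.2 v), fun ι _ A x hA => ?_⟩
  · exact le_of_sq_le_sq ((hg.2.1 v).trans (hS' v).le) (norm_nonneg _)
  · have h1 := hgD _ ⟨ι, _, A, x, hA, rfl⟩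
    simp only [sub_apply, sum_apply, hS'] at h1
    linarith

end DualOpAlg

/-! ### From vector representations to semi-invariant subspaces -/

namespace DualOpAlg

variable {H V : Type*} [NormedAddCommGroup H] [InnerProductSpace ℂ H]
  [NormedAddCommGroup V] [InnerProductSpace ℂ V]

/-- A representation `Ψ` with `E a Ξ = c Ψ(a)` is similar, through `E`, to the compression of the
algebra to a semi-invariant subspace. -/
theorem exists_semiInvariant_of_factorization [CompleteSpace H] [FiniteDimensional ℂ V]
    (𝔄 : Subalgebra ℂ (H →L[ℂ] H)) (Ψ : 𝔄 →ₐ[ℂ] (V →L[ℂ] V)) (Ξ : V →L[ℂ] H) (Q : H →L[ℂ] V)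
    {c : ℝ} (hc : 0 < c)
    (h : ∀ (a : 𝔄) v, Q ((a : H →L[ℂ] H) (Ξ v)) = (c : ℂ) • Ψ a v) :
    ∃ (K : Submodule ℂ H) (_ : K.HasOrthogonalProjection) (T : V ≃L[ℂ] K),
      IsSemiInvariant 𝔄 K ∧
      (∀ a : 𝔄, Ψ a = T.symm.toContinuousLinearMap ∘L
        compression K (a : H →L[ℂ] H) ∘L T.toContinuousLinearMap) ∧
      ‖T.toContinuousLinearMap‖ ≤ ‖Ξ‖ / c ∧ ‖T.symm.toContinuousLinearMap‖ ≤ ‖Q‖ := by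
  have hc0 : (c : ℂ) ≠ 0 := by exact_mod_cast hc.ne'
  let M₀ : Submodule ℂ H := Submodule.span ℂ {y | ∃ (a : 𝔄) (v : V), y = (a : H →L[ℂ] H) (Ξ v)}
  let M : Submodule ℂ H := M₀.topologicalClosure
  let N : Submodule ℂ H := M ⊓ LinearMap.ker Q.toLinearMap
  have hMc : IsClosed (M : Set H) := M₀.isClosed_topologicalClosure
  have hNc : IsClosed (N : Set H) := hMc.inter Q.isClosed_ker
  have hMinv : ∀ a ∈ 𝔄, ∀ x ∈ M, a x ∈ M := fun a ha x hx => by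
    have h1 : M₀ ≤ M.comap a.toLinearMap := by
      refine Submodule.span_le.2 ?_
      rintro _ ⟨b, v, rfl⟩
      exact M₀.le_topologicalClosure (Submodule.subset_span ⟨⟨a, ha⟩ * b, v, rfl⟩)
    exact M₀.topologicalClosure_minimal h1 (hMc.preimage a.continuous) hx
  -- On the cyclic space `Q` intertwines `a` with `Ψ a`; this is what makes its kernel there, `N`,
  -- invariant.
  have hQ : ∀ (a : 𝔄), ∀ x ∈ M, Q ((a : H →L[ℂ] H) x) = Ψ a (Q x) := fun a x hx => by
    have h1 : M₀ ≤ LinearMap.eqLocus (Q ∘L (a : H →L[ℂ] H)).toLinearMap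
        (Ψ a ∘L Q).toLinearMap := by
      refine Submodule.span_le.2 ?_
      rintro _ ⟨b, v, rfl⟩
      have h2 := h (a * b) v
      rw [map_mul, mul_apply_eq_comp] at h2
      change Q ((a : H →L[ℂ] H) ((b : H →L[ℂ] H) (Ξ v))) = Ψ a (Q ((b : H →L[ℂ] H) (Ξ v)))
      rw [h, map_smul, ← h2]
      rfl
    exact M₀.topologicalClosure_minimal h1
      (isClosed_eq (Q ∘L (a : H →L[ℂ] H)).continuous (Ψ a ∘L Q).continuous) hx
  have hNinv : ∀ a ∈ 𝔄, ∀ x ∈ N, a x ∈ N := fun a ha x hx => by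
    refine ⟨hMinv a ha x hx.1, ?_⟩
    have h1 : Q x = 0 := hx.2
    change Q (a x) = 0
    rw [hQ ⟨a, ha⟩ x hx.1, h1, map_zero]
  let K : Submodule ℂ H := M ⊓ Nᗮ
  have hKc : IsClosed (K : Set H) := hMc.inter N.isClosed_orthogonal
  have : CompleteSpace K := hKc.completeSpace_coe
  have : CompleteSpace N := hNc.completeSpace_coe
  have hsub : ∀ x ∈ M, x - N.starProjection x ∈ K := fun x hx =>
    ⟨M.sub_mem hx (N.starProjection_apply_mem x).1, N.sub_starProjection_mem_orthogonal x⟩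
  have hQsub : ∀ x, Q (x - N.starProjection x) = Q x := fun x => by
    have : Q (N.starProjection x) = 0 := (N.starProjection_apply_mem x).2
    rw [map_sub, this, sub_zero]
  have hΞ : ∀ v, Ξ v ∈ M := fun v =>
    M₀.le_topologicalClosure (Submodule.subset_span ⟨1, v, rfl⟩)
  have hQΞ : ∀ v, Q (Ξ v) = (c : ℂ) • v := fun v => by simpa using h 1 v
  have hcomp : ∀ x ∈ M, (K.orthogonalProjectionOnto x : H) = x - N.starProjection x :=
    fun x hx => by
      refine K.eq_starProjection_of_mem_of_inner_eq_zero (hsub x hx) fun w hw => ?_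
      rw [sub_sub_cancel]
      exact hw.2 _ (N.starProjection_apply_mem x)
  -- Since `Q Ξ = c` and `Q` kills `N`, the projection of `c⁻¹ Ξ` off `N` is a right inverse of `Q`.
  -- It is two-sided on `K`, where `Q` is injective because `K ⟂ N`.
  let lift : V →ₗ[ℂ] K := LinearMap.codRestrict K
    ((LinearMap.id - N.starProjection.toLinearMap) ∘ₗ ((c : ℂ)⁻¹ • Ξ.toLinearMap)) fun v =>
      hsub _ (M.smul_mem _ (hΞ v))
  have hlift : ∀ v, (lift v : H) = (c : ℂ)⁻¹ • Ξ v - N.starProjection ((c : ℂ)⁻¹ • Ξ v) :=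
    fun v => rfl
  have hleft : ∀ v, Q (lift v) = v := fun v => by
    rw [hlift, hQsub, map_smul, hQΞ, inv_smul_smul₀ hc0]
  have hinj : ∀ x : K, Q x = 0 → x = 0 := fun x hx => by
    have h1 : inner ℂ (x : H) x = 0 := x.2.2 _ ⟨x.2.1, hx⟩
    exact Subtype.ext (inner_self_eq_zero.1 h1)
  let T₀ : V ≃ₗ[ℂ] K := LinearEquiv.ofLinearMap lift (Q.toLinearMap ∘ₗ K.subtype)
    (by
      ext x : 1
      refine sub_eq_zero.1 (hinj _ ?_)
      change Q ((lift (Q x) : H) - x) = 0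
      rw [map_sub, hleft, sub_self])
    (by
      ext v : 1
      exact hleft v)
  have hT₀ : Continuous T₀ := LinearMap.continuous_of_finiteDimensional T₀.toLinearMap
  have hT₀' : Continuous T₀.symm := Q.continuous.comp continuous_subtype_val
  let T : V ≃L[ℂ] K := ⟨T₀, hT₀, hT₀'⟩
  have hTs : ∀ x : K, T.symm x = Q x := fun x => rfl
  have hQT : ∀ v, Q (T v) = v := hleft
  refine ⟨K, inferInstance, T, ⟨M, N, hMc, hNc, inf_le_left, hMinv, hNinv, rfl⟩, fun a => ?_,
    ?_, ?_⟩
  · ext v : 1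
    change Ψ a v = T.symm (K.orthogonalProjectionOnto ((a : H →L[ℂ] H) (T v)))
    rw [hTs, hcomp _ (hMinv a a.2 _ (T v).2.1), hQsub, hQ a _ (T v).2.1, hQT]
  · refine ContinuousLinearMap.opNorm_le_bound _ (by positivity) fun v => ?_
    change ‖(lift v : H)‖ ≤ _
    rw [hlift]
    have h1 : ‖(c : ℂ)⁻¹ • Ξ v - N.starProjection ((c : ℂ)⁻¹ • Ξ v)‖ ≤ ‖(c : ℂ)⁻¹ • Ξ v‖ := by
      have h2 : (c : ℂ)⁻¹ • Ξ v - N.starProjection ((c : ℂ)⁻¹ • Ξ v) =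
          Nᗮ.starProjection ((c : ℂ)⁻¹ • Ξ v) := by
        rw [N.starProjection_orthogonal']; rfl
      rw [h2]
      exact Nᗮ.norm_starProjection_apply_le _
    refine h1.trans ?_
    rw [norm_smul, norm_inv, Complex.norm_real, Real.norm_eq_abs, abs_of_pos hc, div_mul_eq_mul_div,
      inv_mul_eq_div]
    gcongr
    exact Ξ.le_opNorm v
  · refine ContinuousLinearMap.opNorm_le_bound _ (norm_nonneg _) fun x => ?_
    exact Q.le_opNorm _

/-- Two nearby operators which are almost inverse to each other's adjoint have norm close to `1`. -/
theorem norm_le_of_re_inner_le {A B : V →L[ℂ] H} {τ : ℝ} (hτ : 0 ≤ τ)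
    (h : ∀ v, (inner ℂ (A v) (B v)).re ≤ ‖v‖ ^ 2) (hd : ∀ v, ‖A v - B v‖ ≤ τ * ‖v‖) :
    ‖A‖ ≤ 1 + τ := by
  refine A.opNorm_le_bound (by positivity) fun v => ?_
  have h1 : ‖A v‖ ^ 2 = (inner ℂ (A v) (B v)).re + (inner ℂ (A v) (A v - B v)).re := by
    rw [inner_sub_right, Complex.sub_re, add_sub_cancel]
    exact (inner_self_eq_norm_sq (𝕜 := ℂ) (A v)).symm
  have h2 : (inner ℂ (A v) (A v - B v)).re ≤ ‖A v‖ * (τ * ‖v‖) :=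
    (re_inner_le_norm (𝕜 := ℂ) _ _).trans (mul_le_mul_of_nonneg_left (hd v) (norm_nonneg _))
  have h3 := h v
  -- If `‖A v‖ > (1 + τ)‖v‖`, multiplying by `‖A v‖` and using `‖v‖ ≤ ‖A v‖` gives `‖A v‖² > ‖v‖² +
  -- τ ‖v‖ ‖A v‖`, against `h1`, `h2`, `h3`.
  by_contra! h4
  have hv := norm_nonneg v
  have h5 : ‖v‖ ≤ ‖A v‖ := by nlinarith [mul_nonneg hτ hv]
  have h6 : ‖v‖ * ‖v‖ ≤ ‖A v‖ * ‖v‖ := mul_le_mul_of_nonneg_right h5 hv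
  have h7 : 0 < ‖A v‖ := by nlinarith [mul_nonneg hτ hv]
  nlinarith [mul_lt_mul_of_pos_left h4 h7]

/-- The synthesis operator `v ↦ ∑ᵢ vᵢ ξᵢ` of a tuple of vectors. -/
def synthesis {k : ℕ} (ξ : Fin k → H) : EuclideanSpace ℂ (Fin k) →L[ℂ] H :=
  ∑ i, (EuclideanSpace.proj i : EuclideanSpace ℂ (Fin k) →L[ℂ] ℂ).smulRight (ξ i)

theorem synthesis_apply {k : ℕ} (ξ : Fin k → H) (v : EuclideanSpace ℂ (Fin k)) :
    synthesis ξ v = ∑ i, v i • ξ i := by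
  simp [synthesis]

theorem norm_synthesis_le {k : ℕ} (ξ : Fin k → H) (v : EuclideanSpace ℂ (Fin k)) :
    ‖synthesis ξ v‖ ≤ √(∑ i, ‖ξ i‖ ^ 2) * ‖v‖ := by
  rw [synthesis_apply, EuclideanSpace.norm_eq, mul_comm]
  refine (norm_sum_le _ _).trans ?_
  simp only [norm_smul]
  exact Real.sum_mul_le_sqrt_mul_sqrt _ _ _

/-- If the scaled coefficients of `Ψ` are vector functionals given by tuples `ξ`, `η` of nearly
minimal norm, then `Ψ` is similar to a compression, by a nearly unitary similarity. -/
theorem exists_semiInvariant_of_vectors [CompleteSpace H] (𝔄 : Subalgebra ℂ (H →L[ℂ] H)) {k : ℕ}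
    (Ψ : 𝔄 →ₐ[ℂ] (EuclideanSpace ℂ (Fin k) →L[ℂ] EuclideanSpace ℂ (Fin k)))
    (ξ η : Fin k → H) {c : ℝ} (hc : 0 < c) (hc1 : c ≤ 1)
    (hξ : ∑ i, ‖ξ i‖ ^ 2 ≤ k) (hη : ∑ i, ‖η i‖ ^ 2 ≤ k)
    (h : ∀ (a : 𝔄) i j, inner ℂ (η i) ((a : H →L[ℂ] H) (ξ j)) =
      c * Ψ a (EuclideanSpace.single j 1) i) :
    ∃ (K : Submodule ℂ H) (_ : K.HasOrthogonalProjection) (T : EuclideanSpace ℂ (Fin k) ≃L[ℂ] K),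
      IsSemiInvariant 𝔄 K ∧
      (∀ a : 𝔄, Ψ a = T.symm.toContinuousLinearMap ∘L
        compression K (a : H →L[ℂ] H) ∘L T.toContinuousLinearMap) ∧
      ‖T.toContinuousLinearMap‖ ≤ (1 + √(2 * k * (1 - c))) / c ∧
      ‖T.symm.toContinuousLinearMap‖ ≤ 1 + √(2 * k * (1 - c)) := by
  set τ := √(2 * k * (1 - c))
  have hform : ∀ (a : 𝔄) v w, inner ℂ (synthesis η w) ((a : H →L[ℂ] H) (synthesis ξ v)) =
      (c : ℂ) * inner ℂ w (Ψ a v) := fun a v w => by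
    have hv : v = ∑ j, v j • EuclideanSpace.single j (1 : ℂ) := by
      conv_lhs => rw [← (EuclideanSpace.basisFun (Fin k) ℂ).sum_repr v]
      simp
    have hΨ : ∀ i, Ψ a v i = ∑ j, v j * Ψ a (EuclideanSpace.single j 1) i := fun i => by
      conv_lhs => rw [hv]
      simp
    simp only [synthesis_apply, map_sum, map_smul, sum_inner, inner_sum, inner_smul_left,
      inner_smul_right, h, PiLp.inner_apply, RCLike.inner_apply, hΨ, Finset.mul_sum,
      Finset.sum_mul]
    rw [Finset.sum_comm]
    refine Finset.sum_congr rfl fun i _ => Finset.sum_congr rfl fun j _ => ?_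
    ring
  have hre : ∀ v, (inner ℂ (synthesis η v) (synthesis ξ v)).re = c * ‖v‖ ^ 2 := fun v => by
    have h1 := hform 1 v v
    rw [map_one, OneMemClass.coe_one, one_apply_eq_self, one_apply_eq_self] at h1
    rw [h1, Complex.re_ofReal_mul]
    congr 1
    exact inner_self_eq_norm_sq (𝕜 := ℂ) v
  have hle : ∀ v, (inner ℂ (synthesis η v) (synthesis ξ v)).re ≤ ‖v‖ ^ 2 := fun v => by
    rw [hre]
    exact mul_le_of_le_one_left (by positivity) hc1
  -- Taking `a = 1` gives `⟨ξᵢ, ηᵢ⟩ = c`, so expanding the squares leaves at most `k - 2kc + k`.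
  have hsum : ∑ i, ‖ξ i - η i‖ ^ 2 ≤ 2 * k * (1 - c) := by
    have h1 : ∀ i, ‖ξ i - η i‖ ^ 2 = ‖ξ i‖ ^ 2 - 2 * c + ‖η i‖ ^ 2 := fun i => by
      rw [@norm_sub_sq ℂ, ← inner_conj_symm]
      have h2 := h 1 i i
      simp only [map_one, OneMemClass.coe_one, one_apply_eq_self, PiLp.single_apply, if_true,
        mul_one] at h2
      rw [h2]
      simp
    simp only [h1, Finset.sum_add_distrib, Finset.sum_sub_distrib, Finset.sum_const,
      Finset.card_univ, Fintype.card_fin, nsmul_eq_mul]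
    linarith
  have hdiff : ∀ v, ‖synthesis ξ v - synthesis η v‖ ≤ τ * ‖v‖ := fun v => by
    have h1 : synthesis ξ v - synthesis η v = synthesis (ξ - η) v := by
      simp [synthesis_apply, smul_sub]
    rw [h1]
    refine (norm_synthesis_le _ v).trans ?_
    exact mul_le_mul_of_nonneg_right (Real.sqrt_le_sqrt hsum) (norm_nonneg _)
  have hτ : 0 ≤ τ := Real.sqrt_nonneg _
  have hnξ : ‖synthesis ξ‖ ≤ 1 + τ := norm_le_of_re_inner_le (B := synthesis η) hτ
    (fun v => by
      rw [← inner_conj_symm, Complex.conj_re]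
      exact hle v) hdiff
  have hnη : ‖synthesis η‖ ≤ 1 + τ := norm_le_of_re_inner_le (B := synthesis ξ) hτ hle
    (fun v => by
      rw [norm_sub_rev]
      exact hdiff v)
  obtain ⟨K, hK, T, h1, h2, h3, h4⟩ := exists_semiInvariant_of_factorization 𝔄 Ψ (synthesis ξ)
    (ContinuousLinearMap.adjoint (synthesis η)) hc (fun a v => by
      refine ext_inner_left ℂ fun w => ?_
      rw [ContinuousLinearMap.adjoint_inner_right, hform, inner_smul_right])
  refine ⟨K, hK, T, h1, h2, h3.trans (by gcongr), h4.trans ?_⟩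
  rwa [LinearIsometryEquiv.norm_map]

end DualOpAlg

/-! ### Topologies, operator matrices and their entries -/

namespace DualOpAlg

variable {H F : Type*} [NormedAddCommGroup H] [InnerProductSpace ℂ H]
  [NormedAddCommGroup F] [InnerProductSpace ℂ F]

/-- Comparing the topologies makes `𝔄` norm closed, as the Neumann series requires, and the
representation norm continuous, as finiteness of the completely bounded norm requires. -/
theorem continuous_pairing (ξ η : lp (fun _ : ℕ => H) 2) :
    Continuous (pairing ξ η : (H →L[ℂ] H) → ℂ) := by
  have hs : Summable fun n => ‖η n‖ * ‖ξ n‖ := by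
    have hξ : Summable fun n => ‖ξ n‖ ^ 2 := by
      simpa using (lp.memℓp ξ).summable (by norm_num)
    have hη : Summable fun n => ‖η n‖ ^ 2 := by
      simpa using (lp.memℓp η).summable (by norm_num)
    refine Summable.of_nonneg_of_le (fun n => by positivity) (fun n => ?_) (hξ.add hη)
    nlinarith [sq_nonneg (‖η n‖ - ‖ξ n‖), sq_nonneg (‖η n‖), sq_nonneg (‖ξ n‖)]
  let f : (H →L[ℂ] H) →ₗ[ℂ] ℂ :=
    { toFun := pairing ξ η
      map_add' := fun S T => by
        simp only [pairing, add_apply, inner_add_right]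
        exact (summable_pairing ξ η S).tsum_add (summable_pairing ξ η T)
      map_smul' := fun c T => by
        simp only [pairing, smul_apply, inner_smul_right]
        exact tsum_mul_left }
  refine (f.mkContinuous (∑' n, ‖η n‖ * ‖ξ n‖) fun T => ?_).continuous
  rw [mul_comm, ← tsum_mul_left]
  refine tsum_of_norm_bounded (hs.mul_left ‖T‖).hasSum fun n => ?_
  calc ‖inner ℂ (η n) (T (ξ n))‖ ≤ ‖η n‖ * ‖T (ξ n)‖ := norm_inner_le_norm _ _
    _ ≤ ‖η n‖ * (‖T‖ * ‖ξ n‖) := by gcongr; exact T.le_opNorm _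
    _ = ‖T‖ * (‖η n‖ * ‖ξ n‖) := by ring

/-- The weak-* topology is coarser than the norm topology. -/
theorem norm_topology_le_weakStarTopology :
    (inferInstance : TopologicalSpace (H →L[ℂ] H)) ≤ weakStarTopology H :=
  le_iInf fun p => continuous_iff_le_induced.1 (continuous_pairing p.1 p.2)

theorem norm_topology_le_weakStarTopologyOn (𝔄 : Subalgebra ℂ (H →L[ℂ] H)) :
    (inferInstance : TopologicalSpace 𝔄) ≤ weakStarTopologyOn 𝔄 :=
  induced_mono norm_topology_le_weakStarTopology

theorem blockOp_map_apply {R : Type*} [Ring R] [Algebra ℂ R] (θ : R →ₐ[ℂ] (F →L[ℂ] F)) {n : ℕ}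
    (A : Matrix (Fin n) (Fin n) R) (x : PiLp 2 fun _ : Fin n => F) (i : Fin n) :
    blockOp n (A.map θ) x i = amp θ A x i := by
  rw [blockOp_apply]; rfl

theorem norm_blockOp_map_le_iff {R : Type*} [Ring R] [Algebra ℂ R] (θ : R →ₐ[ℂ] (F →L[ℂ] F))
    {n : ℕ} (A : Matrix (Fin n) (Fin n) R) {ρ : ℝ} (hρ : 0 ≤ ρ) :
    ‖blockOp n (A.map θ)‖ ≤ ρ ↔ AmpBound θ ρ A := by
  rw [ContinuousLinearMap.opNorm_le_iff hρ]
  have key : ∀ x : PiLp 2 fun _ : Fin n => F, ‖blockOp n (A.map θ) x‖ ≤ ρ * ‖x‖ ↔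
      ∑ i, ‖amp θ A x i‖ ^ 2 ≤ ρ ^ 2 * ∑ j, ‖x j‖ ^ 2 := fun x => by
    rw [← sq_le_sq₀ (norm_nonneg _) (by positivity), mul_pow, PiLp.norm_sq_eq_of_L2,
      PiLp.norm_sq_eq_of_L2]
    simp only [blockOp_map_apply]
  exact ⟨fun h x => (key (WithLp.toLp 2 x)).1 (h _), fun h x => (key x).2 (h x)⟩

theorem amp_reindex {R : Type*} [Ring R] [Algebra ℂ R] (θ : R →ₐ[ℂ] (F →L[ℂ] F))
    {ι κ : Type*} [Fintype ι] [Fintype κ] (e : ι ≃ κ) (A : Matrix ι ι R) (x : κ → F) :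
    amp θ (A.submatrix e.symm e.symm) x = amp θ A (x ∘ e) ∘ e.symm := by
  funext i
  simp only [amp, Matrix.submatrix_apply, Function.comp_apply]
  rw [← e.sum_comp]
  simp

theorem ampBound_submatrix_iff {R : Type*} [Ring R] [Algebra ℂ R] (θ : R →ₐ[ℂ] (F →L[ℂ] F))
    {ι κ : Type*} [Fintype ι] [Fintype κ] (e : ι ≃ κ) (A : Matrix ι ι R) {ρ : ℝ} :
    AmpBound θ ρ (A.submatrix e.symm e.symm) ↔ AmpBound θ ρ A := by
  have key : ∀ x : κ → F, ∑ i, ‖amp θ (A.submatrix e.symm e.symm) x i‖ ^ 2 ≤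
      ρ ^ 2 * ∑ j, ‖x j‖ ^ 2 ↔ ∑ i, ‖amp θ A (x ∘ e) i‖ ^ 2 ≤ ρ ^ 2 * ∑ j, ‖(x ∘ e) j‖ ^ 2 :=
    fun x => by
      rw [amp_reindex, ← e.sum_comp, ← e.sum_comp fun j => ‖x j‖ ^ 2]
      simp
  refine ⟨fun h x => ?_, fun h x => (key x).2 (h _)⟩
  have h1 := (key (x ∘ e.symm)).1 (h _)
  rwa [Function.comp_assoc, e.symm_comp_self, Function.comp_id] at h1

/-- `cbNorm` runs over the types `Fin n`, `CBBound` over all finite types, where direct sums are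
convenient; reindexing reconciles the two. -/
theorem cbNorm_le_ofReal_iff (𝔄 : Subalgebra ℂ (H →L[ℂ] H)) (Φ : 𝔄 →ₐ[ℂ] (F →L[ℂ] F)) {C : ℝ}
    (hC : 0 ≤ C) : cbNorm 𝔄 Φ ≤ ENNReal.ofReal C ↔ CBBound 𝔄.val Φ C := by
  have h : ∀ {n : ℕ} (A : Matrix (Fin n) (Fin n) 𝔄),
      ‖blockOp n (A.map Φ)‖ₑ ≤ ENNReal.ofReal C ↔ AmpBound Φ C A := fun A => by
    rw [← norm_blockOp_map_le_iff _ _ hC, ← ofReal_norm, ENNReal.ofReal_le_ofReal_iff hC]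
  simp only [cbNorm, iSup_le_iff, h]
  constructor
  · intro H N _ A hA
    rw [← ampBound_submatrix_iff _ (Fintype.equivFin N)] at hA ⊢
    exact H _ _ ((norm_blockOp_map_le_iff 𝔄.val _ zero_le_one).2 hA)
  · intro H n A hA
    exact H _ _ ((norm_blockOp_map_le_iff 𝔄.val _ zero_le_one).1 hA)

/-- The entries of an operator on `H^{⊕n}`. -/
def blockEntry (n : ℕ) (i j : Fin n) :
    (PiLp 2 (fun _ : Fin n => H) →L[ℂ] PiLp 2 (fun _ : Fin n => H)) →L[ℂ] (H →L[ℂ] H) :=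
  (ContinuousLinearMap.compL ℂ H (PiLp 2 fun _ : Fin n => H) H
    (PiLp.proj 2 (fun _ : Fin n => H) i)) ∘L
  (ContinuousLinearMap.compL ℂ H (PiLp 2 fun _ : Fin n => H) (PiLp 2 fun _ : Fin n => H)).flip
    ((PiLp.continuousLinearEquiv 2 ℂ (fun _ : Fin n => H)).symm.toContinuousLinearMap ∘L
      ContinuousLinearMap.single ℂ (fun _ : Fin n => H) j)

theorem blockEntry_apply {n : ℕ} (i j : Fin n)
    (T : PiLp 2 (fun _ : Fin n => H) →L[ℂ] PiLp 2 (fun _ : Fin n => H)) (x : H) :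
    blockEntry n i j T x = T (PiLp.single 2 j x) i := rfl

theorem blockEntry_blockOp {n : ℕ} (i j : Fin n) (A : Matrix (Fin n) (Fin n) (H →L[ℂ] H)) :
    blockEntry n i j (blockOp n A) = A i j := by
  ext x
  rw [blockEntry_apply, blockOp_apply, Finset.sum_eq_single j] <;> simp +contextual

theorem blockOp_blockEntry {n : ℕ}
    (T : PiLp 2 (fun _ : Fin n => H) →L[ℂ] PiLp 2 (fun _ : Fin n => H)) :
    blockOp n (Matrix.of fun i j => blockEntry n i j T) = T := by
  ext x i
  rw [blockOp_apply]
  have hx : x = ∑ j, PiLp.single 2 j (x j) := by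
    ext i
    simp
  conv_rhs => rw [hx]
  simp [blockEntry_apply]

theorem mem_matrixAlgebra_iff {𝔄 : Subalgebra ℂ (H →L[ℂ] H)} {n : ℕ}
    {T : PiLp 2 (fun _ : Fin n => H) →L[ℂ] PiLp 2 (fun _ : Fin n => H)} :
    T ∈ matrixAlgebra n 𝔄 ↔ ∀ i j, blockEntry n i j T ∈ 𝔄 := by
  constructor
  · rintro ⟨A, hA, rfl⟩ i j
    have := blockEntry_blockOp i j A
    exact this ▸ hA i j
  · intro h
    exact ⟨_, fun i j => h i j, blockOp_blockEntry T⟩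

theorem isClosed_matrixAlgebra {𝔄 : Subalgebra ℂ (H →L[ℂ] H)}
    (h𝔄 : IsClosed (𝔄 : Set (H →L[ℂ] H))) (n : ℕ) :
    IsClosed {T | T ∈ matrixAlgebra n 𝔄} := by
  simp only [mem_matrixAlgebra_iff, Set.ofPred_forall]
  exact isClosed_iInter fun i => isClosed_iInter fun j => h𝔄.preimage (blockEntry n i j).continuous

theorem blockOp_map_val_mem {𝔄 : Subalgebra ℂ (H →L[ℂ] H)} {n : ℕ}
    (A : Matrix (Fin n) (Fin n) 𝔄) : blockOp n (A.map 𝔄.val) ∈ matrixAlgebra n 𝔄 :=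
  ⟨_, fun i j => (A i j).2, rfl⟩

/-- The matrix over `𝔄` of an element of `M_n(𝔄)`. -/
def toMatrix {𝔄 : Subalgebra ℂ (H →L[ℂ] H)} {n : ℕ}
    {T : PiLp 2 (fun _ : Fin n => H) →L[ℂ] PiLp 2 (fun _ : Fin n => H)}
    (hT : T ∈ matrixAlgebra n 𝔄) : Matrix (Fin n) (Fin n) 𝔄 :=
  Matrix.of fun i j => ⟨blockEntry n i j T, mem_matrixAlgebra_iff.1 hT i j⟩

theorem blockOp_toMatrix {𝔄 : Subalgebra ℂ (H →L[ℂ] H)} {n : ℕ}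
    {T : PiLp 2 (fun _ : Fin n => H) →L[ℂ] PiLp 2 (fun _ : Fin n => H)}
    (hT : T ∈ matrixAlgebra n 𝔄) : blockOp n ((toMatrix hT).map 𝔄.val) = T :=
  blockOp_blockEntry T

theorem blockOp_map_val_injective (𝔄 : Subalgebra ℂ (H →L[ℂ] H)) (n : ℕ) :
    Function.Injective fun A : Matrix (Fin n) (Fin n) 𝔄 => blockOp n (A.map 𝔄.val) := by
  intro A B h
  ext i j : 2
  have h1 := congrArg (blockEntry n i j) h
  simp only [blockEntry_blockOp] at h1
  exact h1

/-- The Neumann series converges in norm and its sum stays in `M_n(𝔄)`, which is closed because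
membership is tested entrywise. -/
theorem invertibleNearOne_val [CompleteSpace H] {𝔄 : Subalgebra ℂ (H →L[ℂ] H)}
    (h𝔄 : IsClosed (𝔄 : Set (H →L[ℂ] H))) : InvertibleNearOne 𝔄.val := by
  intro N _ _ D ρ hρ0 hρ hD
  let n := Fintype.card N
  let e : N ≃ Fin n := Fintype.equivFin N
  let A : Matrix (Fin n) (Fin n) 𝔄 := D.submatrix e.symm e.symm
  set b := blockOp n (A.map 𝔄.val) with hb
  have hbn : ‖b‖ < 1 :=
    ((norm_blockOp_map_le_iff _ _ hρ0).2 ((ampBound_submatrix_iff _ e D).2 hD)).trans_lt hρ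
  have hsum := summable_geometric_of_norm_lt_one hbn
  have hmem : ∑' i, b ^ i ∈ matrixAlgebra n 𝔄 := by
    refine (isClosed_matrixAlgebra h𝔄 n).mem_of_tendsto hsum.hasSum (Eventually.of_forall fun s => ?_)
    exact sum_mem fun i _ => pow_mem (blockOp_map_val_mem A) i
  have hmul : ∀ B B' : Matrix (Fin n) (Fin n) 𝔄, blockOp n ((B * B').map 𝔄.val) =
      blockOp n (B.map 𝔄.val) * blockOp n (B'.map 𝔄.val) := fun B B' => by
    rw [Matrix.map_mul, map_mul]
  have hone : blockOp n ((1 : Matrix (Fin n) (Fin n) 𝔄).map 𝔄.val) = 1 := by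
    rw [Matrix.map_one _ (map_zero _) (map_one _), map_one]
  have hsub : blockOp n ((1 - A).map 𝔄.val) = 1 - b := by
    rw [Matrix.map_sub _ (map_sub _), map_sub, hone]
  have h3 : IsUnit (1 - A) := by
    refine ⟨⟨1 - A, toMatrix hmem, ?_, ?_⟩, rfl⟩
    · refine blockOp_map_val_injective 𝔄 n ?_
      change blockOp n _ = blockOp n _
      rw [hmul, hone, hsub, blockOp_toMatrix, mul_neg_geom_series b hbn]
    · refine blockOp_map_val_injective 𝔄 n ?_
      change blockOp n _ = blockOp n _
      rw [hmul, hone, hsub, blockOp_toMatrix, geom_series_mul_neg b hbn]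
  have h4 := h3.map (Matrix.reindexRingEquiv 𝔄 e.symm)
  rw [map_sub, map_one] at h4
  convert h4
  ext i j : 2
  simp [A, Matrix.reindexRingEquiv]

end DualOpAlg

/-! ### Complete boundedness, and vectors from property `𝔸₁(1)` -/

namespace DualOpAlg

variable {H F : Type*} [NormedAddCommGroup H] [InnerProductSpace ℂ H]
  [NormedAddCommGroup F] [InnerProductSpace ℂ F]

/-- Bounded functionals are completely bounded, with the same norm. -/
theorem sum_norm_sq_functional_le {𝔄 : Subalgebra ℂ (H →L[ℂ] H)} (f : 𝔄 →L[ℂ] ℂ) {N : Type*}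
    [Fintype N] {A : Matrix N N 𝔄} (hA : AmpBound 𝔄.val 1 A) (s : N → ℂ) :
    ∑ i, ‖∑ j, s j * f (A i j)‖ ^ 2 ≤ ‖f‖ ^ 2 * ∑ j, ‖s j‖ ^ 2 := by
  set u : N → ℂ := fun i => ∑ j, s j * f (A i j) with hu
  set U := ∑ i, ‖u i‖ ^ 2 with hU
  set X := ∑ j, ‖s j‖ ^ 2
  have hU0 : 0 ≤ U := by positivity
  have hX0 : 0 ≤ X := by positivity
  -- Evaluating `f` at `b = u* A s` returns `∑ ‖uᵢ‖²`, while `‖b‖ ≤ ‖u‖ ‖s‖`.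
  let b : 𝔄 := ∑ i, (starRingEnd ℂ) (u i) • ∑ j, s j • A i j
  have hfb : f b = (U : ℂ) := by
    simp only [b, map_sum, map_smul, smul_eq_mul, hU, Complex.ofReal_sum]
    refine Finset.sum_congr rfl fun i _ => ?_
    rw [Complex.ofReal_pow]
    exact RCLike.conj_mul (u i)
  have hb : ‖b‖ ≤ √U * √X := by
    refine ContinuousLinearMap.opNorm_le_bound _ (by positivity) fun h => ?_
    have h1 : (b : H →L[ℂ] H) h = ∑ i, (starRingEnd ℂ) (u i) • amp 𝔄.val A (fun j => s j • h) i := by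
      simp [b, amp, sum_apply]
    have h2 := hA fun j => s j • h
    simp only [norm_smul, mul_pow, ← Finset.sum_mul] at h2
    change ‖(b : H →L[ℂ] H) h‖ ≤ _
    rw [h1]
    refine (norm_sum_le _ _).trans ?_
    simp only [norm_smul, RCLike.norm_conj]
    refine (Real.sum_mul_le_sqrt_mul_sqrt _ _ _).trans ?_
    rw [mul_assoc]
    refine mul_le_mul_of_nonneg_left ?_ (Real.sqrt_nonneg _)
    refine Real.sqrt_le_iff.2 ⟨by positivity, ?_⟩
    rw [mul_pow, Real.sq_sqrt hX0]
    linarith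
  have h3 : U ≤ ‖f‖ * (√U * √X) := by
    have h4 := (f.le_opNorm b).trans (mul_le_mul_of_nonneg_left hb (norm_nonneg _))
    rwa [hfb, Complex.norm_real, Real.norm_eq_abs, abs_of_nonneg hU0] at h4
  have h5 : √U ≤ ‖f‖ * √X := by
    rcases (Real.sqrt_nonneg U).eq_or_lt with h0 | h0
    · rw [← h0]; positivity
    · refine le_of_mul_le_mul_left ?_ h0
      rw [Real.mul_self_sqrt hU0]
      linarith
  calc U = √U ^ 2 := (Real.sq_sqrt hU0).symm
    _ ≤ (‖f‖ * √X) ^ 2 := by gcongr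
    _ = ‖f‖ ^ 2 * X := by rw [mul_pow, Real.sq_sqrt hX0]

/-- A bounded representation on a finite dimensional space is completely bounded. -/
theorem exists_cbBound {𝔄 : Subalgebra ℂ (H →L[ℂ] H)} {k : ℕ}
    (Φ : 𝔄 →ₐ[ℂ] (EuclideanSpace ℂ (Fin k) →L[ℂ] EuclideanSpace ℂ (Fin k)))
    (hΦ : Continuous Φ) : ∃ C, 0 ≤ C ∧ CBBound 𝔄.val Φ C := by
  let f : Fin k → Fin k → 𝔄 →L[ℂ] ℂ := fun p q =>
    (EuclideanSpace.proj p : EuclideanSpace ℂ (Fin k) →L[ℂ] ℂ) ∘L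
      ContinuousLinearMap.apply ℂ _ (EuclideanSpace.single q (1 : ℂ)) ∘L ⟨Φ.toLinearMap, hΦ⟩
  have hf : ∀ a v p, Φ a v p = ∑ q, v q * f p q a := fun a v p => by
    conv_lhs => rw [← (EuclideanSpace.basisFun (Fin k) ℂ).sum_repr v]
    simp [f]
    rfl
  let B := ∑ p, ∑ q, ‖f p q‖ ^ 2
  have hB : 0 ≤ B := by positivity
  -- The factor `k` comes from Cauchy–Schwarz over the `k` columns; `B` collects the squared norms
  -- of the coefficient functionals.
  refine ⟨√(k * B), Real.sqrt_nonneg _, fun N _ A hA v => ?_⟩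
  rw [Real.sq_sqrt (by positivity)]
  have h1 : ∀ i p, ‖amp Φ A v i p‖ ^ 2 ≤ k * ∑ q, ‖∑ j, v j q * f p q (A i j)‖ ^ 2 :=
    fun i p => by
      have h2 : amp Φ A v i p = ∑ q, ∑ j, v j q * f p q (A i j) := by
        simp only [amp, WithLp.ofLp_sum, Finset.sum_apply, hf]
        exact Finset.sum_comm
      rw [h2]
      calc ‖∑ q, ∑ j, v j q * f p q (A i j)‖ ^ 2 ≤ (∑ q, ‖∑ j, v j q * f p q (A i j)‖) ^ 2 := by
            gcongr
            exact norm_sum_le _ _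
        _ ≤ _ := by
            refine sq_sum_le_card_mul_sum_sq.trans ?_
            simp
  have h3 : ∀ q, ∑ j, ‖v j q‖ ^ 2 ≤ ∑ j, ‖v j‖ ^ 2 := fun q => by
    refine Finset.sum_le_sum fun j _ => ?_
    gcongr
    exact PiLp.norm_apply_le (v j) q
  calc ∑ i, ‖amp Φ A v i‖ ^ 2 = ∑ i, ∑ p, ‖amp Φ A v i p‖ ^ 2 := by
        simp only [EuclideanSpace.norm_sq_eq]
    _ ≤ ∑ i, ∑ p, k * ∑ q, ‖∑ j, v j q * f p q (A i j)‖ ^ 2 := by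
        gcongr with i _ p _
        exact h1 i p
    _ = k * ∑ p, ∑ q, ∑ i, ‖∑ j, v j q * f p q (A i j)‖ ^ 2 := by
        rw [Finset.sum_comm, Finset.mul_sum]
        refine Finset.sum_congr rfl fun p _ => ?_
        rw [← Finset.mul_sum, Finset.sum_comm]
    _ ≤ k * ∑ p, ∑ q, ‖f p q‖ ^ 2 * ∑ j, ‖v j‖ ^ 2 := by
        gcongr with p _ q _
        refine (sum_norm_sq_functional_le (f p q) hA _).trans ?_
        exact mul_le_mul_of_nonneg_left (h3 q) (by positivity)
    _ = k * B * ∑ j, ‖v j‖ ^ 2 := by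
        rw [mul_assoc]
        simp only [B, Finset.sum_mul]

/-- Compressions are completely contractive. -/
theorem cbBound_of_similar_compression {𝔄 : Subalgebra ℂ (H →L[ℂ] H)} (Φ : 𝔄 →ₐ[ℂ] (F →L[ℂ] F))
    (K : Submodule ℂ H) [K.HasOrthogonalProjection] (T : F ≃L[ℂ] K)
    (h : ∀ a : 𝔄, Φ a = T.symm.toContinuousLinearMap ∘L
        compression K (a : H →L[ℂ] H) ∘L T.toContinuousLinearMap) :
    CBBound 𝔄.val Φ (‖T.toContinuousLinearMap‖ * ‖T.symm.toContinuousLinearMap‖) := by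
  intro N _ A hA v
  have h1 : ∀ i, amp Φ A v i = T.symm (K.orthogonalProjectionOnto
      (amp 𝔄.val A (fun j => (T (v j) : H)) i)) := fun i => by
    simp only [amp, map_sum, h]
    rfl
  have h2 : ∀ i, ‖amp Φ A v i‖ ^ 2 ≤ ‖T.symm.toContinuousLinearMap‖ ^ 2 *
      ‖amp 𝔄.val A (fun j => (T (v j) : H)) i‖ ^ 2 := fun i => by
    rw [h1, ← mul_pow]
    gcongr
    refine (T.symm.toContinuousLinearMap.le_opNorm _).trans ?_
    gcongr
    exact K.norm_orthogonalProjectionOnto_apply_le _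
  have h3 : ∀ j, ‖(T (v j) : H)‖ ^ 2 ≤ ‖T.toContinuousLinearMap‖ ^ 2 * ‖v j‖ ^ 2 := fun j => by
    rw [← mul_pow]
    gcongr
    exact T.toContinuousLinearMap.le_opNorm _
  calc ∑ i, ‖amp Φ A v i‖ ^ 2 ≤ ‖T.symm.toContinuousLinearMap‖ ^ 2 *
        ∑ i, ‖amp 𝔄.val A (fun j => (T (v j) : H)) i‖ ^ 2 := by
        rw [Finset.mul_sum]
        exact Finset.sum_le_sum fun i _ => h2 i
    _ ≤ ‖T.symm.toContinuousLinearMap‖ ^ 2 * ∑ j, ‖(T (v j) : H)‖ ^ 2 := by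
        exact mul_le_mul_of_nonneg_left (by simpa using hA fun j => (T (v j) : H)) (by positivity)
    _ ≤ ‖T.symm.toContinuousLinearMap‖ ^ 2 * ∑ j, ‖T.toContinuousLinearMap‖ ^ 2 * ‖v j‖ ^ 2 := by
        gcongr with j _
        exact h3 j
    _ = _ := by rw [← Finset.mul_sum]; ring

/-- Pairing an entry of `T` is pairing `T` itself with sequences supported in one coordinate. -/
theorem continuous_pairing_blockEntry {k : ℕ} (i j : Fin k) (ξ η : lp (fun _ : ℕ => H) 2) :
    Continuous[weakStarTopology (PiLp 2 fun _ : Fin k => H), inferInstance]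
      fun T => pairing ξ η (blockEntry k i j T) := by
  have hmem : ∀ (l : Fin k) (ζ : lp (fun _ : ℕ => H) 2), Memℓp
      (fun n => (PiLp.single 2 l (ζ n) : PiLp 2 fun _ : Fin k => H)) 2 := fun l ζ =>
    memℓp_gen (by simpa using (lp.memℓp ζ).summable (by norm_num))
  let p : lp (fun _ : ℕ => PiLp 2 fun _ : Fin k => H) 2 := ⟨_, hmem j ξ⟩
  let q : lp (fun _ : ℕ => PiLp 2 fun _ : Fin k => H) 2 := ⟨_, hmem i η⟩
  have h : (fun T => pairing ξ η (blockEntry k i j T)) = pairing p q := by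
    funext T
    refine tsum_congr fun n => ?_
    rw [blockEntry_apply]
    change _ = inner ℂ (PiLp.single 2 i (η n) : PiLp 2 fun _ : Fin k => H)
      (T (PiLp.single 2 j (ξ n)))
    rw [PiLp.inner_apply, Finset.sum_eq_single i] <;> simp +contextual
  rw [h]
  exact continuous_iff_le_induced.2 (iInf_le _ (p, q))

/-- The topologies are implicit arguments, not instances, because the weak-* and norm topologies
live on the same type. -/
theorem continuous_comp_of {X Y Z : Type*} {tX : TopologicalSpace X} {tY : TopologicalSpace Y}
    {tZ : TopologicalSpace Z} {g : Y → Z} {f : X → Y} (hg : Continuous[tY, tZ] g)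
    (hf : Continuous[tX, tY] f) : Continuous[tX, tZ] (g ∘ f) :=
  hg.comp hf

/-- Property `𝔸₁(1)` for a functional given as a linear map with a bound. -/
theorem HasA11.exists_of_linearMap {𝔅 : Subalgebra ℂ (H →L[ℂ] H)} (h𝔅 : HasA11 𝔅)
    (f : 𝔅 →ₗ[ℂ] ℂ) (hf : Continuous[weakStarTopologyOn 𝔅, inferInstance] f) {ρ : ℝ}
    (hρ0 : 0 ≤ ρ) (hρ : ρ < 1)
    (hbound : ∀ (b : 𝔅) (t : ℝ), 0 < t → ‖(b : H →L[ℂ] H)‖ ≤ t → ‖f b‖ ≤ ρ * t) :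
    ∃ ξ η : H, ‖ξ‖ < 1 ∧ ‖η‖ < 1 ∧ ∀ b : 𝔅, f b = inner ℂ η ((b : H →L[ℂ] H) ξ) := by
  have hle : ∀ b : 𝔅, ‖f b‖ ≤ ρ * ‖b‖ := fun b => by
    -- The bound is assumed for `t > 0` only, so that matrices can be rescaled by `ρ / t`; letting
    -- `t` decrease to `‖b‖` recovers the operator norm.
    refine le_of_forall_pos_le_add fun ε hε => ?_
    refine (hbound b (‖b‖ + ε) (by positivity) (le_add_of_nonneg_right hε.le)).trans ?_
    nlinarith
  let f' : 𝔅 →L[ℂ] ℂ := ⟨f, AddMonoidHomClass.continuous_of_bound f ρ hle⟩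
  have hn : ‖f'‖ < 1 := (ContinuousLinearMap.opNorm_le_bound f' hρ0 hle).trans_lt hρ
  exact h𝔅 f' hf hn

/-- Property `𝔸₁(1)` represents the scaled coefficients of a completely contractive representation
by tuples of vectors. -/
theorem HasA11.exists_vectors {𝔄 : Subalgebra ℂ (H →L[ℂ] H)} {k : ℕ}
    (hA11 : HasA11 (matrixAlgebra k 𝔄))
    (Ψ : 𝔄 →ₐ[ℂ] (EuclideanSpace ℂ (Fin k) →L[ℂ] EuclideanSpace ℂ (Fin k)))
    (hΨ : Continuous[weakStarTopologyOn 𝔄, inferInstance] Ψ) {ρ : ℝ} (hρ0 : 0 < ρ) (hρ : ρ < 1)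
    (hbd : ∀ A : Matrix (Fin k) (Fin k) 𝔄, AmpBound 𝔄.val ρ A → AmpBound Ψ 1 A) :
    ∃ ξ η : Fin k → H, ∑ i, ‖ξ i‖ ^ 2 ≤ k ∧ ∑ i, ‖η i‖ ^ 2 ≤ k ∧
      ∀ (a : 𝔄) i j, inner ℂ (η i) ((a : H →L[ℂ] H) (ξ j)) =
        ((ρ ^ 2 : ℝ) : ℂ) * Ψ a (EuclideanSpace.single j 1) i := by
  let e : Fin k → EuclideanSpace ℂ (Fin k) := fun j => EuclideanSpace.single j 1
  -- Only an inequality: for `k = 0` the product is `0`.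
  have hk : (k : ℝ)⁻¹ * k ≤ 1 := by
    rw [inv_mul_eq_div]
    exact div_self_le_one _
  have hbd' : ∀ (A : Matrix (Fin k) (Fin k) 𝔄) (t : ℝ), 0 < t → AmpBound 𝔄.val t A →
      AmpBound Ψ (t / ρ) A := fun A t ht hA => by
    have h1 : AmpBound 𝔄.val ρ (((ρ / t : ℝ) : ℂ) • A) := fun x => by
      have h2 := hA x
      simp only [amp_smul, Pi.smul_apply, norm_smul, Complex.norm_real, Real.norm_eq_abs, mul_pow,
        sq_abs, ← Finset.mul_sum]
      calc (ρ / t) ^ 2 * ∑ i, ‖amp 𝔄.val A x i‖ ^ 2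
          ≤ (ρ / t) ^ 2 * (t ^ 2 * ∑ j, ‖x j‖ ^ 2) := by gcongr
        _ = ρ ^ 2 * ∑ j, ‖x j‖ ^ 2 := by field_simp
    intro x
    have h2 := hbd _ h1 x
    simp only [amp_smul, Pi.smul_apply, norm_smul, Complex.norm_real, Real.norm_eq_abs, mul_pow,
      sq_abs, ← Finset.mul_sum] at h2
    calc ∑ i, ‖amp Ψ A x i‖ ^ 2 = (t / ρ) ^ 2 * ((ρ / t) ^ 2 * ∑ i, ‖amp Ψ A x i‖ ^ 2) := by
          field_simp
      _ ≤ (t / ρ) ^ 2 * (1 ^ 2 * ∑ j, ‖x j‖ ^ 2) := by gcongr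
      _ = (t / ρ) ^ 2 * ∑ j, ‖x j‖ ^ 2 := by ring
  -- One factor `ρ` absorbs the loss in `t / ρ`, the other makes the functional strictly
  -- contractive; `k⁻¹` offsets the two factors `√k` from Cauchy–Schwarz and from the norm of the
  -- tuple `e`.
  let c : ℝ := ρ ^ 2 * (k : ℝ)⁻¹
  have hc0 : 0 ≤ c := by positivity
  let ent : Fin k → Fin k → matrixAlgebra k 𝔄 →ₗ[ℂ] 𝔄 := fun i j =>
    LinearMap.codRestrict 𝔄.toSubmodule
      ((blockEntry k i j).toLinearMap ∘ₗ (matrixAlgebra k 𝔄).val.toLinearMap)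
      fun B => mem_matrixAlgebra_iff.1 B.2 i j
  let coef : Fin k → Fin k → 𝔄 →ₗ[ℂ] ℂ := fun i j =>
    (EuclideanSpace.proj i : EuclideanSpace ℂ (Fin k) →L[ℂ] ℂ).toLinearMap ∘ₗ
      (ContinuousLinearMap.apply ℂ _ (e j)).toLinearMap ∘ₗ Ψ.toLinearMap
  let f₀ : matrixAlgebra k 𝔄 →ₗ[ℂ] ℂ := (c : ℂ) • ∑ i, ∑ j, coef i j ∘ₗ ent i j
  have hf₀ : ∀ B : matrixAlgebra k 𝔄, f₀ B = c * ∑ i, amp Ψ (toMatrix B.2) e i i := fun B => by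
    simp [f₀, coef, amp]
    left
    rfl
  have hbound : ∀ (B : matrixAlgebra k 𝔄) (t : ℝ), 0 < t → ‖B.1‖ ≤ t → ‖f₀ B‖ ≤ ρ * t := by
    intro B t ht hB
    have h1 : AmpBound 𝔄.val t (toMatrix B.2) := by
      rwa [← norm_blockOp_map_le_iff _ _ ht.le, blockOp_toMatrix]
    have h2 := hbd' _ _ ht h1 e
    have h3 : ∑ j, ‖e j‖ ^ 2 = (k : ℝ) := by simp [e]
    rw [h3] at h2
    rw [hf₀, norm_mul, Complex.norm_real, Real.norm_eq_abs, abs_of_nonneg hc0]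
    have h4 : ‖∑ i, amp Ψ (toMatrix B.2) e i i‖ ≤ k * (t / ρ) := by
      calc ‖∑ i, amp Ψ (toMatrix B.2) e i i‖ ≤ ∑ i, 1 * ‖amp Ψ (toMatrix B.2) e i‖ := by
            refine (norm_sum_le _ _).trans (Finset.sum_le_sum fun i _ => ?_)
            rw [one_mul]
            exact PiLp.norm_apply_le _ i
        _ ≤ √(∑ i : Fin k, 1 ^ 2) * √(∑ i, ‖amp Ψ (toMatrix B.2) e i‖ ^ 2) :=
            Real.sum_mul_le_sqrt_mul_sqrt _ _ _
        _ ≤ √k * √((t / ρ) ^ 2 * k) := by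
            gcongr
            simp
        _ = k * (t / ρ) := by
            rw [Real.sqrt_mul (by positivity), Real.sqrt_sq (by positivity), mul_left_comm,
              Real.mul_self_sqrt (by positivity), mul_comm]
    calc c * ‖∑ i, amp Ψ (toMatrix B.2) e i i‖ ≤ c * (k * (t / ρ)) := by gcongr
      _ = ρ * t * ((k : ℝ)⁻¹ * k) := by
          simp only [c]
          field_simp
      _ ≤ ρ * t := mul_le_of_le_one_right (by positivity) hk
  have hent : ∀ i j, Continuous[weakStarTopologyOn (matrixAlgebra k 𝔄), weakStarTopologyOn 𝔄]
      (ent i j) := fun i j => by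
    refine continuous_induced_rng.2 (continuous_iInf_rng.2 fun p => continuous_induced_rng.2 ?_)
    exact continuous_comp_of (g := fun T => pairing p.1 p.2 (blockEntry k i j T))
      (f := fun B : matrixAlgebra k 𝔄 => B.1) (continuous_pairing_blockEntry i j p.1 p.2)
      continuous_induced_dom
  have hcoef : ∀ i j, Continuous[weakStarTopologyOn 𝔄, inferInstance] (coef i j) := fun i j => by
    have h1 : Continuous fun T : EuclideanSpace ℂ (Fin k) →L[ℂ] EuclideanSpace ℂ (Fin k) =>
      T (e j) i := by fun_prop
    have h2 := continuous_comp_of h1 hΨ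
    exact h2
  have hsum : ∀ {X : Type _} [TopologicalSpace X] (g : Fin k → Fin k → X → ℂ),
      (∀ i j, Continuous (g i j)) → Continuous fun x => (c : ℂ) * ∑ i, ∑ j, g i j x :=
    fun g hg => continuous_const.mul
      (continuous_finsetSum _ fun i _ => continuous_finsetSum _ fun j _ => hg i j)
  have hfc : Continuous[weakStarTopologyOn (matrixAlgebra k 𝔄), inferInstance] f₀ := by
    have h1 := @hsum _ (weakStarTopologyOn (matrixAlgebra k 𝔄)) (fun i j => coef i j ∘ ent i j)
      fun i j => continuous_comp_of (hcoef i j) (hent i j)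
    convert h1 using 1
    funext B
    simp [f₀]
  obtain ⟨ξ, η, hξ, hη, h⟩ :=
    hA11.exists_of_linearMap f₀ hfc hρ0.le hρ hbound
  have hscale : ∀ ζ : PiLp 2 fun _ : Fin k => H, ‖ζ‖ < 1 →
      ∑ i, ‖((√k : ℝ) : ℂ) • ζ i‖ ^ 2 ≤ k := fun ζ hζ => by
    simp only [norm_smul, mul_pow, ← Finset.mul_sum, ← PiLp.norm_sq_eq_of_L2, Complex.norm_real,
      Real.norm_eq_abs, sq_abs, Real.sq_sqrt (Nat.cast_nonneg k)]
    exact mul_le_of_le_one_right (by positivity) (pow_le_one₀ (norm_nonneg _) hζ.le)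
  refine ⟨fun i => ((√k : ℝ) : ℂ) • ξ i, fun i => ((√k : ℝ) : ℂ) • η i, hscale ξ hξ, hscale η hη,
    fun a i j => ?_⟩
  have hk0 : (k : ℂ) ≠ 0 := Nat.cast_ne_zero.2 (Fin.pos i).ne'
  -- Testing on the matrix with the single entry `a` isolates one coefficient; the two factors `√k`
  -- cancel the `k⁻¹` in `c`.
  let A : Matrix (Fin k) (Fin k) 𝔄 := Matrix.single i j a
  have h1 := h ⟨_, blockOp_map_val_mem A⟩
  have h2 : toMatrix (blockOp_map_val_mem A) = A :=
    blockOp_map_val_injective 𝔄 k (blockOp_toMatrix _)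
  have h3 : ∀ l, amp Ψ A e l l = if l = i then Ψ a (e j) i else 0 := fun l => by
    simp only [amp, A, WithLp.ofLp_sum, Finset.sum_apply]
    rw [Finset.sum_eq_single j]
    · split_ifs with hl
      · subst hl; simp
      · rw [Matrix.single_apply_of_row_ne (Ne.symm hl)]; simp
    · intro b _ hb
      rw [Matrix.single_apply_of_col_ne _ _ (Ne.symm hb)]; simp
    · simp
  have h4 : inner ℂ η (blockOp k (A.map 𝔄.val) ξ) = inner ℂ (η i) ((a : H →L[ℂ] H) (ξ j)) := by
    rw [PiLp.inner_apply, Finset.sum_eq_single i]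
    · rw [blockOp_map_apply, amp, Finset.sum_eq_single j]
      · simp [A]
      · intro b _ hb
        simp only [A]
        rw [Matrix.single_apply_of_col_ne _ _ (Ne.symm hb)]; simp
      · simp
    · intro b _ hb
      rw [blockOp_map_apply, amp, Finset.sum_eq_zero, inner_zero_right]
      intro l _
      simp only [A]
      rw [Matrix.single_apply_of_row_ne (Ne.symm hb)]; simp
    · simp
  have h5 : f₀ ⟨_, blockOp_map_val_mem A⟩ = c * Ψ a (e j) i := by
    rw [hf₀]
    simp only [h2, h3, Finset.sum_ite_eq', Finset.mem_univ, if_true]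
  rw [h5] at h1
  rw [map_smul, inner_smul_left, inner_smul_right, ← h4]
  refine (congrArg _ (congrArg _ h1.symm)).trans ?_
  rw [Complex.conj_ofReal, ← mul_assoc, ← Complex.ofReal_mul,
    Real.mul_self_sqrt (Nat.cast_nonneg k)]
  simp only [c]
  push_cast
  field_simp
  rfl

end DualOpAlg

/-! ### Condition numbers near the completely bounded norm -/

namespace DualOpAlg

/-- The `1 × 1` identity matrix is a contraction and acts as the identity on a nonzero vector. -/
theorem one_le_of_cbBound {R E V : Type*} [Ring R] [Algebra ℂ R] [NormedAddCommGroup E]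
    [InnerProductSpace ℂ E] [NormedAddCommGroup V] [InnerProductSpace ℂ V] [Nontrivial V]
    {θ : R →ₐ[ℂ] (E →L[ℂ] E)} {Φ : R →ₐ[ℂ] (V →L[ℂ] V)} {C : ℝ} (hC : 0 ≤ C)
    (h : CBBound θ Φ C) : 1 ≤ C := by
  obtain ⟨v, hv⟩ := exists_ne (0 : V)
  have h1 := h (Fin 1) 1 (fun x => by simp [amp_one]) fun _ => v
  simp only [amp_one, Finset.univ_unique, Finset.sum_const, Finset.card_singleton, one_smul] at h1
  have hv' : 0 < ‖v‖ ^ 2 := by positivity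
  have h2 : 1 ≤ C ^ 2 := by
    by_contra! h3
    nlinarith
  exact (one_le_sq_iff₀ hC).1 h2

variable {H : Type*} [NormedAddCommGroup H] [InnerProductSpace ℂ H] [CompleteSpace H]

/-- Conjugating by an almost optimal similarity and representing the resulting representation by
vectors gives a compression similar to `Φ`, with explicit control of the condition number. -/
theorem exists_compression_of_lt_one {𝔄 : Subalgebra ℂ (H →L[ℂ] H)}
    (h𝔄 : IsClosed (𝔄 : Set (H →L[ℂ] H))) {k : ℕ} (hA11 : HasA11 (matrixAlgebra k 𝔄))
    (Φ : 𝔄 →ₐ[ℂ] (EuclideanSpace ℂ (Fin k) →L[ℂ] EuclideanSpace ℂ (Fin k)))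
    (hΦ : Continuous[weakStarTopologyOn 𝔄, inferInstance] Φ) {C : ℝ} (hC : 1 ≤ C)
    (hcb : CBBound 𝔄.val Φ C) {ρ : ℝ} (hρ0 : 0 < ρ) (hρ : ρ < 1) :
    ∃ (K : Submodule ℂ H) (_ : K.HasOrthogonalProjection) (T : EuclideanSpace ℂ (Fin k) ≃L[ℂ] K),
      IsSemiInvariant 𝔄 K ∧
      (∀ a : 𝔄, Φ a = T.symm.toContinuousLinearMap ∘L
        compression K (a : H →L[ℂ] H) ∘L T.toContinuousLinearMap) ∧
      ‖T.toContinuousLinearMap‖ * ‖T.symm.toContinuousLinearMap‖ ≤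
        (1 + √(2 * k * (1 - ρ ^ 2))) / ρ ^ 2 * C * (1 + √(2 * k * (1 - ρ ^ 2))) := by
  have hC0 : 0 ≤ C := by linarith
  obtain ⟨S, hS1, hS2, hS⟩ := hcb.exists_similarity (invertibleNearOne_val h𝔄) hC hρ0.le hρ
  have hinj : Function.Injective S.toLinearMap := by
    refine (injective_iff_map_eq_zero _).2 fun v hv => norm_le_zero_iff.1 ?_
    refine (hS1 v).trans ?_
    rw [show S v = 0 from hv, norm_zero]
  let e : EuclideanSpace ℂ (Fin k) ≃L[ℂ] EuclideanSpace ℂ (Fin k) :=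
    (LinearEquiv.ofInjectiveEndo S.toLinearMap hinj).toContinuousLinearEquiv
  have he : ∀ v, e v = S v := fun v => rfl
  let Ψ : 𝔄 →ₐ[ℂ] (EuclideanSpace ℂ (Fin k) →L[ℂ] EuclideanSpace ℂ (Fin k)) :=
    e.conjContinuousAlgEquiv.toAlgEquiv.toAlgHom.comp Φ
  have hΨ : ∀ a v, Ψ a v = S (Φ a (e.symm v)) := fun a v => rfl
  have hΨc : Continuous[weakStarTopologyOn 𝔄, inferInstance] Ψ := by
    have h1 := continuous_comp_of e.conjContinuousAlgEquiv.continuous hΦ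
    exact h1
  obtain ⟨ξ, η, hξ, hη, h⟩ := hA11.exists_vectors Ψ hΨc hρ0 hρ fun A hA x => by
    have h1 := hS _ A (fun j => e.symm (x j)) hA
    have h2 : ∀ i, amp Ψ A x i = S (amp Φ A (fun j => e.symm (x j)) i) := fun i => by
      simp only [amp, hΨ, map_sum]
    simp only [← he, e.apply_symm_apply] at h1
    simpa only [h2, ← he, one_pow, one_mul] using h1
  obtain ⟨K, hK, T, hsemi, hT, hn, hn'⟩ := exists_semiInvariant_of_vectors 𝔄 Ψ ξ η
    (by positivity : 0 < ρ ^ 2) (pow_le_one₀ hρ0.le hρ.le) hξ hη h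
  refine ⟨K, hK, e.trans T, hsemi, fun a => ?_, ?_⟩
  · ext v : 1
    have h1 := congrArg (fun Q => e.symm (Q (e v))) (hT a)
    simp only [hΨ, ← he, e.symm_apply_apply] at h1
    exact h1
  · rw [mul_assoc]
    have h1 : ‖(e.trans T).toContinuousLinearMap‖ ≤
        (1 + √(2 * k * (1 - ρ ^ 2))) / ρ ^ 2 * C := by
      refine ContinuousLinearMap.opNorm_le_bound _ (by positivity) fun v => ?_
      refine (T.toContinuousLinearMap.le_opNorm (e v)).trans ?_
      rw [mul_assoc]
      exact mul_le_mul hn (hS2 v) (norm_nonneg _) (by positivity)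
    have h2 : ‖(e.trans T).symm.toContinuousLinearMap‖ ≤ 1 + √(2 * k * (1 - ρ ^ 2)) := by
      refine ContinuousLinearMap.opNorm_le_bound _ (by positivity) fun x => ?_
      refine (hS1 (e.symm (T.symm x))).trans ?_
      rw [← he, e.apply_symm_apply]
      exact (T.symm.toContinuousLinearMap.le_opNorm x).trans
        (mul_le_mul_of_nonneg_right hn' (norm_nonneg _))
    rw [← mul_assoc]
    exact mul_le_mul h1 h2 (ContinuousLinearMap.opNorm_nonneg _) (by positivity)

/-- The similarity to a compression with condition number arbitrarily close to the completely
bounded norm. -/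
theorem exists_compression_near_cbBound {𝔄 : Subalgebra ℂ (H →L[ℂ] H)}
    (h𝔄 : IsClosed (𝔄 : Set (H →L[ℂ] H))) {k : ℕ} (hA11 : HasA11 (matrixAlgebra k 𝔄))
    (Φ : 𝔄 →ₐ[ℂ] (EuclideanSpace ℂ (Fin k) →L[ℂ] EuclideanSpace ℂ (Fin k)))
    (hΦ : Continuous[weakStarTopologyOn 𝔄, inferInstance] Φ) {C : ℝ} (hC : 0 ≤ C)
    (hcb : CBBound 𝔄.val Φ C) {δ : ℝ} (hδ : 0 < δ) :
    ∃ (K : Submodule ℂ H) (_ : K.HasOrthogonalProjection) (T : EuclideanSpace ℂ (Fin k) ≃L[ℂ] K),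
      IsSemiInvariant 𝔄 K ∧
      (∀ a : 𝔄, Φ a = T.symm.toContinuousLinearMap ∘L
        compression K (a : H →L[ℂ] H) ∘L T.toContinuousLinearMap) ∧
      ‖T.toContinuousLinearMap‖ * ‖T.symm.toContinuousLinearMap‖ ≤ C + δ := by
  rcases Nat.eq_zero_or_pos k with rfl | hk
  -- For `k = 0` the inequality `1 ≤ C` may fail, but every operator on the zero space has norm `0`.
  · obtain ⟨K, hK, T, h1, h2, -, -⟩ := exists_semiInvariant_of_vectors 𝔄 Φ 0 0 zero_lt_one le_rfl
      (by simp) (by simp) fun _ i => i.elim0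
    refine ⟨K, hK, T, h1, h2, ?_⟩
    have h3 : ‖T.toContinuousLinearMap‖ = 0 :=
      le_antisymm (ContinuousLinearMap.opNorm_le_bound _ le_rfl fun v => by
        rw [Subsingleton.elim v 0]
        simp) (ContinuousLinearMap.opNorm_nonneg _)
    rw [h3, zero_mul]
    positivity
  · have : NeZero k := ⟨hk.ne'⟩
    have hC1 : 1 ≤ C := one_le_of_cbBound hC hcb
    -- At `ρ = 1` the square roots vanish, leaving exactly `C`.
    have hlim : Tendsto (fun ρ : ℝ => (1 + √(2 * k * (1 - ρ ^ 2))) / ρ ^ 2 * C *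
        (1 + √(2 * k * (1 - ρ ^ 2)))) (𝓝 1) (𝓝 C) := by
      have h1 : ContinuousAt (fun ρ : ℝ => (1 + √(2 * k * (1 - ρ ^ 2))) / ρ ^ 2 * C *
          (1 + √(2 * k * (1 - ρ ^ 2)))) 1 := by
        refine ContinuousAt.mul (ContinuousAt.mul (ContinuousAt.div ?_ ?_ (by norm_num)) ?_) ?_ <;>
          fun_prop
      simpa [ContinuousAt] using h1
    have h1 := (hlim.eventually_le_const (lt_add_of_pos_right C hδ)).filter_mono
      (nhdsWithin_le_nhds (s := Set.Iio 1))
    obtain ⟨ρ, h2, hρ0, hρ⟩ := (h1.and (Ioo_mem_nhdsLT (zero_lt_one' ℝ))).exists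
    obtain ⟨K, hK, T, h3, h4, h5⟩ := exists_compression_of_lt_one h𝔄 hA11 Φ hΦ hC1 hcb hρ0 hρ
    exact ⟨K, hK, T, h3, h4, h5.trans h2⟩

end DualOpAlg

end

theorem mainTheorem7 {H : Type*} [NormedAddCommGroup H] [InnerProductSpace ℂ H] [CompleteSpace H]
    (𝔄 : Subalgebra ℂ (H →L[ℂ] H))
    (h𝔄 : IsClosed[DualOpAlg.weakStarTopology H] (𝔄 : Set (H →L[ℂ] H)))
    (k : ℕ) (hA11 : DualOpAlg.HasA11 (DualOpAlg.matrixAlgebra k 𝔄))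
    (φ : 𝔄 →ₐ[ℂ] Matrix (Fin k) (Fin k) ℂ)
    (hφ : Continuous[DualOpAlg.weakStarTopologyOn 𝔄, inferInstance] φ) :
    DualOpAlg.cbNorm 𝔄 (fun a => Matrix.toEuclideanCLM (n := Fin k) (𝕜 := ℂ) (φ a)) ≠ ∞ ∧
    ∃ (K : ℝ → Submodule ℂ H) (_ : ∀ ε, (K ε).HasOrthogonalProjection)
      (T : ∀ ε, EuclideanSpace ℂ (Fin k) ≃L[ℂ] K ε),
      (∀ ε > 0, DualOpAlg.IsSemiInvariant 𝔄 (K ε) ∧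
        ∀ a : 𝔄, Matrix.toEuclideanCLM (n := Fin k) (𝕜 := ℂ) (φ a) =
          (T ε).symm.toContinuousLinearMap ∘L
            DualOpAlg.compression (K ε) (a : H →L[ℂ] H) ∘L (T ε).toContinuousLinearMap) ∧
      Tendsto (fun ε => ‖(T ε).toContinuousLinearMap‖ * ‖(T ε).symm.toContinuousLinearMap‖)
        (𝓝[>] 0)
        (𝓝 (DualOpAlg.cbNorm 𝔄
          (fun a => Matrix.toEuclideanCLM (n := Fin k) (𝕜 := ℂ) (φ a))).toReal) := by
  let Φ : 𝔄 →ₐ[ℂ] (EuclideanSpace ℂ (Fin k) →L[ℂ] EuclideanSpace ℂ (Fin k)) :=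
    (Matrix.toEuclideanCLM (n := Fin k) (𝕜 := ℂ)).toAlgEquiv.toAlgHom.comp φ
  have hΦ : Continuous[DualOpAlg.weakStarTopologyOn 𝔄, inferInstance] Φ := by
    have h1 : Continuous (Matrix.toEuclideanCLM (n := Fin k) (𝕜 := ℂ)) :=
      LinearMap.continuous_of_finiteDimensional
        (Matrix.toEuclideanCLM (n := Fin k) (𝕜 := ℂ)).toAlgEquiv.toLinearMap
    have h2 := DualOpAlg.continuous_comp_of h1 hφ
    exact h2
  have h𝔄' : IsClosed (𝔄 : Set (H →L[ℂ] H)) :=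
    h𝔄.mono DualOpAlg.norm_topology_le_weakStarTopology
  have hΦ' : Continuous Φ :=
    continuous_le_dom (DualOpAlg.norm_topology_le_weakStarTopologyOn 𝔄) hΦ
  change DualOpAlg.cbNorm 𝔄 Φ ≠ ∞ ∧ ∃ (K : ℝ → Submodule ℂ H)
    (_ : ∀ ε, (K ε).HasOrthogonalProjection) (T : ∀ ε, EuclideanSpace ℂ (Fin k) ≃L[ℂ] K ε),
    (∀ ε > 0, DualOpAlg.IsSemiInvariant 𝔄 (K ε) ∧ ∀ a : 𝔄, Φ a =
      (T ε).symm.toContinuousLinearMap ∘L DualOpAlg.compression (K ε) (a : H →L[ℂ] H) ∘L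
        (T ε).toContinuousLinearMap) ∧
    Tendsto (fun ε => ‖(T ε).toContinuousLinearMap‖ * ‖(T ε).symm.toContinuousLinearMap‖)
      (𝓝[>] 0) (𝓝 (DualOpAlg.cbNorm 𝔄 Φ).toReal)
  have hfin : DualOpAlg.cbNorm 𝔄 Φ ≠ ∞ := by
    obtain ⟨C, hC, h⟩ := DualOpAlg.exists_cbBound Φ hΦ'
    exact ne_top_of_le_ne_top ENNReal.ofReal_ne_top
      ((DualOpAlg.cbNorm_le_ofReal_iff 𝔄 Φ hC).2 h)
  have hcb : DualOpAlg.CBBound 𝔄.val Φ (DualOpAlg.cbNorm 𝔄 Φ).toReal :=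
    (DualOpAlg.cbNorm_le_ofReal_iff 𝔄 Φ ENNReal.toReal_nonneg).1 (ENNReal.ofReal_toReal hfin).ge
  have hex : ∀ ε : ℝ, ∃ (K : Submodule ℂ H) (_ : K.HasOrthogonalProjection)
      (T : EuclideanSpace ℂ (Fin k) ≃L[ℂ] K), DualOpAlg.IsSemiInvariant 𝔄 K ∧
      (∀ a : 𝔄, Φ a = T.symm.toContinuousLinearMap ∘L
        DualOpAlg.compression K (a : H →L[ℂ] H) ∘L T.toContinuousLinearMap) ∧
      (0 < ε → ‖T.toContinuousLinearMap‖ * ‖T.symm.toContinuousLinearMap‖ ≤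
        (DualOpAlg.cbNorm 𝔄 Φ).toReal + ε) := fun ε => by
    obtain ⟨K, hK, T, h1, h2, h3⟩ := DualOpAlg.exists_compression_near_cbBound h𝔄' hA11 Φ hΦ
      -- The families are indexed by all real `ε`; for `ε ≤ 0` any positive tolerance serves.
      ENNReal.toReal_nonneg hcb (δ := if 0 < ε then ε else 1) (by split_ifs <;> linarith)
    exact ⟨K, hK, T, h1, h2, fun hε => by rwa [if_pos hε] at h3⟩
  choose K hK T hsemi hT hle using hex
  refine ⟨hfin, K, hK, T, fun ε _ => ⟨hsemi ε, hT ε⟩, ?_⟩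
  have hge : ∀ ε, (DualOpAlg.cbNorm 𝔄 Φ).toReal ≤
      ‖(T ε).toContinuousLinearMap‖ * ‖(T ε).symm.toContinuousLinearMap‖ := fun ε =>
    ENNReal.toReal_le_of_le_ofReal (by positivity) ((DualOpAlg.cbNorm_le_ofReal_iff 𝔄 Φ
      (by positivity)).2 (DualOpAlg.cbBound_of_similar_compression Φ (K ε) (T ε) (hT ε)))
  refine tendsto_of_tendsto_of_tendsto_of_le_of_le' tendsto_const_nhds
    (h := fun ε => (DualOpAlg.cbNorm 𝔄 Φ).toReal + ε) ?_ (Eventually.of_forall hge)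
    (eventually_mem_nhdsWithin.mono fun ε hε => hle ε hε)
  have h1 : Tendsto (fun ε => (DualOpAlg.cbNorm 𝔄 Φ).toReal + ε) (𝓝 0)
      (𝓝 ((DualOpAlg.cbNorm 𝔄 Φ).toReal + 0)) := tendsto_const_nhds.add tendsto_id
  rw [add_zero] at h1
  exact h1.mono_left nhdsWithin_le_nhds
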